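/- For strings $A$, $B$, $P$ over an arbitrary alphabet, with $|A|=|B|=n$, a string $Z$ is an STR-IC-LCS of $A$ and $B$ including $P$ if $Z$ is a longest string such that $P$ is a substring (contiguous factor) of $Z$ and $Z$ is a subsequence of both $A$ and $B$. Let $\ell=\mathsf{lcs}(A,B)$ be the length of a longest common subsequence of $A$ and $B$. The STR-IC-LCS problem (given $A$, $B$ and $P$, output an STR-IC-LCS $Z$ and its length, or report that none exists, which is given the length $-1$) can be solved in $O(n^2)$ time and $O((\ell+1)(n-\ell+1))$ words of working space. Precisely: on the word RAM with read-only access to the inputs, unit-cost instructions on $w$-bit words, equality tests as the only operation on symbols besides copying them to a write-only output, there are one program and one constant $C$ such that, for every alphabet, all $A,B,P$ as above and every word length $w$ with $|P|<2^w$ and $C(n+1)^2\le 2^w$, the program halts with a correct answer after at most $C(n^2+1)$ steps and uses at most $C(\ell+1)(n-\ell+1)$ words (registers and working memory). In particular, the same program uses $O(n)$ space when $\ell=O(1)$ or $n-\ell=O(1)$: for every $c$ there is $K$ such that the working space is at most $K(n+1)$ words whenever $\ell\le c$ or $n-\ell\le c$. -/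

import Mathlib

universe u

namespace StrIcLcs

/-! ### Strings: a string over the alphabet `α` is a `List α`; a subsequence is a `List.Sublist`
(`<+`), a substring (contiguous factor) is a `List.IsInfix` (`<:+:`). -/

/-- `Z` is a common subsequence of `A` and `B`. -/
def IsCommonSubseq {α : Type*} (A B Z : List α) : Prop :=
  List.Sublist Z A ∧ List.Sublist Z B

/-- The length of a longest common subsequence of `A` and `B`. -/
noncomputable def lcs {α : Type*} (A B : List α) : ℕ :=
  sSup {k : ℕ | ∃ Z : List α, IsCommonSubseq A B Z ∧ Z.length = k}

/-- The supremum in the definition of `lcs` is attained. -/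
theorem lcs_isGreatest {α : Type*} (A B : List α) :
    IsGreatest {k : ℕ | ∃ Z : List α, IsCommonSubseq A B Z ∧ Z.length = k} (lcs A B) := by
  have hb : BddAbove {k : ℕ | ∃ Z : List α, IsCommonSubseq A B Z ∧ Z.length = k} :=
    ⟨A.length, by rintro k ⟨Z, hZ, rfl⟩; exact hZ.1.length_le⟩
  have hne : {k : ℕ | ∃ Z : List α, IsCommonSubseq A B Z ∧ Z.length = k}.Nonempty :=
    ⟨0, [], ⟨List.nil_sublist A, List.nil_sublist B⟩, rfl⟩
  exact ⟨Nat.sSup_mem hne hb, fun k hk => le_csSup hb hk⟩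

/-- `Z` is a common subsequence of `A` and `B` that has `P` as a substring. -/
def IsFeasible {α : Type*} (A B P Z : List α) : Prop :=
  List.IsInfix P Z ∧ IsCommonSubseq A B Z

/-- `Z` is an STR-IC-LCS of `A` and `B` including `P`. -/
def IsSTRICLCS {α : Type*} (A B P Z : List α) : Prop :=
  IsFeasible A B P Z ∧ ∀ Z' : List α, IsFeasible A B P Z' → Z'.length ≤ Z.length

/-! ### The machine model: a word RAM

The machine has finitely many registers and a random access working memory, whose cells all hold
`w`-bit words (numbers below `2 ^ w`), read-only access to the three input strings, and a
write-only output string.  The symbols of the alphabet are atomic: a program can test two input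
symbols for equality and can copy an input symbol to the output, and nothing else.  Programs are
structured programs over elementary instructions; every elementary instruction and every
evaluation of a test takes one unit of time. -/

/-- The names of the three input strings. -/
inductive Inp : Type
  | A
  | B
  | P

/-- The assignment of the actual strings to the names of the input strings. -/
def input {α : Type*} (A B P : List α) : Inp → List α
  | Inp.A => A
  | Inp.B => B
  | Inp.P => P

/-- Arithmetic operations; their results are reduced modulo `2 ^ w`. -/
inductive Arith : Type
  | add
  | sub
  | mul

/-- The values of the arithmetic operations on `w`-bit words (subtraction stops at `0`). -/
def Arith.eval (w : ℕ) : Arith → ℕ → ℕ → ℕ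
  | Arith.add, a, b => (a + b) % 2 ^ w
  | Arith.sub, a, b => a - b
  | Arith.mul, a, b => (a * b) % 2 ^ w

/-- Tests. `lt a b` and `eq a b` compare the contents of the registers `a` and `b`;
`sym u a v b` asks whether the symbol of the input string `u` at the position in register `a`
is the symbol of the input string `v` at the position in register `b`. -/
inductive Test : Type
  | lt (a b : ℕ)
  | eq (a b : ℕ)
  | sym (u : Inp) (a : ℕ) (v : Inp) (b : ℕ)

/-- Programs. Registers are named by natural numbers. -/
inductive Prog : Type
  /-- do nothing -/
  | skip
  /-- put the constant `c` into register `d` -/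
  | const (d c : ℕ)
  /-- copy register `a` to register `d` -/
  | copy (d a : ℕ)
  /-- apply an arithmetic operation to registers `a` and `b`, result into register `d` -/
  | arith (f : Arith) (d a b : ℕ)
  /-- copy the memory cell whose address is in register `a` to register `d` -/
  | load (d a : ℕ)
  /-- copy register `b` to the memory cell whose address is in register `a` -/
  | store (a b : ℕ)
  /-- put the length of the input string `u` into register `d` -/
  | len (d : ℕ) (u : Inp)
  /-- append to the output the symbol of `u` at the position in register `a` -/
  | emit (u : Inp) (a : ℕ)
  /-- sequential composition -/
  | seq (p q : Prog)
  /-- branch on a test -/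
  | branch (b : Test) (p q : Prog)
  /-- repeat `p` while the test succeeds -/
  | loop (b : Test) (p : Prog)

/-- A bound above the names of the registers in a test. -/
def Test.numRegs : Test → ℕ
  | Test.lt a b => max (a + 1) (b + 1)
  | Test.eq a b => max (a + 1) (b + 1)
  | Test.sym _ a _ b => max (a + 1) (b + 1)

/-- The number of registers that a program needs: all registers that it names are smaller,
and register `0`, which receives a result, is counted too. -/
def Prog.numRegs : Prog → ℕ
  | Prog.skip => 1
  | Prog.const d _ => d + 1
  | Prog.copy d a => max (d + 1) (a + 1)
  | Prog.arith _ d a b => max (d + 1) (max (a + 1) (b + 1))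
  | Prog.load d a => max (d + 1) (a + 1)
  | Prog.store a b => max (a + 1) (b + 1)
  | Prog.len d _ => d + 1
  | Prog.emit _ a => a + 1
  | Prog.seq p q => max p.numRegs q.numRegs
  | Prog.branch b p q => max b.numRegs (max p.numRegs q.numRegs)
  | Prog.loop b p => max b.numRegs p.numRegs

/-- The state of the machine: registers, working memory, and the output written so far. -/
structure State (α : Type*) where
  reg : ℕ → ℕ
  mem : ℕ → ℕ
  out : List α

/-- The initial state: registers and memory are zero, the output is empty. -/
def State.init (α : Type*) : State α where
  reg := fun _ => 0
  mem := fun _ => 0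
  out := []

/-- Write the word `v` into register `d`. -/
def State.setReg {α : Type*} (σ : State α) (d v : ℕ) : State α :=
  { σ with reg := Function.update σ.reg d v }

/-- Write the word `v` into the memory cell with address `i`. -/
def State.setMem {α : Type*} (σ : State α) (i v : ℕ) : State α :=
  { σ with mem := Function.update σ.mem i v }

/-- `b.Eval x σ r`: in state `σ` on input `x` the test `b` has the result `r`.
Access to a position outside of an input string (positions start at `0`) has no result. -/
inductive Test.Eval {α : Type*} (x : Inp → List α) (σ : State α) : Test → Prop → Prop
  | lt (a b : ℕ) : Test.Eval x σ (Test.lt a b) (σ.reg a < σ.reg b)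
  | eq (a b : ℕ) : Test.Eval x σ (Test.eq a b) (σ.reg a = σ.reg b)
  | sym (u : Inp) (a : ℕ) (v : Inp) (b : ℕ) (ha : σ.reg a < (x u).length)
      (hb : σ.reg b < (x v).length) :
      Test.Eval x σ (Test.sym u a v b) ((x u)[σ.reg a] = (x v)[σ.reg b])

/-- `Exec w m x p σ t τ`: on the machine with `w`-bit words and a working memory of `m` words
(with the addresses below `m`), on input `x`, the program `p` started in state `σ` halts after
exactly `t` time units in state `τ`. An access outside of the memory or outside of an input string
is an error: then there is no such `t` and `τ`. -/
inductive Exec {α : Type*} (w m : ℕ) (x : Inp → List α) :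
    Prog → State α → ℕ → State α → Prop
  | skip (σ : State α) : Exec w m x Prog.skip σ 1 σ
  | const (σ : State α) (d c : ℕ) :
      Exec w m x (Prog.const d c) σ 1 (σ.setReg d (c % 2 ^ w))
  | copy (σ : State α) (d a : ℕ) :
      Exec w m x (Prog.copy d a) σ 1 (σ.setReg d (σ.reg a))
  | arith (σ : State α) (f : Arith) (d a b : ℕ) :
      Exec w m x (Prog.arith f d a b) σ 1 (σ.setReg d (f.eval w (σ.reg a) (σ.reg b)))
  | load (σ : State α) (d a : ℕ) (h : σ.reg a < m) :
      Exec w m x (Prog.load d a) σ 1 (σ.setReg d (σ.mem (σ.reg a)))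
  | store (σ : State α) (a b : ℕ) (h : σ.reg a < m) :
      Exec w m x (Prog.store a b) σ 1 (σ.setMem (σ.reg a) (σ.reg b))
  | len (σ : State α) (d : ℕ) (u : Inp) :
      Exec w m x (Prog.len d u) σ 1 (σ.setReg d ((x u).length % 2 ^ w))
  | emit (σ : State α) (u : Inp) (a : ℕ) (h : σ.reg a < (x u).length) :
      Exec w m x (Prog.emit u a) σ 1 { σ with out := σ.out ++ [(x u)[σ.reg a]] }
  | seq {p q : Prog} {σ ρ τ : State α} {s t : ℕ}
      (hp : Exec w m x p σ s ρ) (hq : Exec w m x q ρ t τ) :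
      Exec w m x (Prog.seq p q) σ (s + t) τ
  | branch_true {b : Test} {r : Prop} {p q : Prog} {σ τ : State α} {t : ℕ}
      (hb : b.Eval x σ r) (hr : r) (hp : Exec w m x p σ t τ) :
      Exec w m x (Prog.branch b p q) σ (1 + t) τ
  | branch_false {b : Test} {r : Prop} {p q : Prog} {σ τ : State α} {t : ℕ}
      (hb : b.Eval x σ r) (hr : ¬ r) (hq : Exec w m x q σ t τ) :
      Exec w m x (Prog.branch b p q) σ (1 + t) τ
  | loop_true {b : Test} {r : Prop} {p : Prog} {σ ρ τ : State α} {s t : ℕ}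
      (hb : b.Eval x σ r) (hr : r) (hp : Exec w m x p σ s ρ)
      (hl : Exec w m x (Prog.loop b p) ρ t τ) :
      Exec w m x (Prog.loop b p) σ (1 + s + t) τ
  | loop_false {b : Test} {r : Prop} {p : Prog} {σ : State α}
      (hb : b.Eval x σ r) (hr : ¬ r) :
      Exec w m x (Prog.loop b p) σ 1 σ

/-- The final state `τ` holds a correct answer to the STR-IC-LCS problem for `A`, `B`, `P`:
the output is an STR-IC-LCS `Z` and register `0` holds `|Z| + 1`, or there is no solution,
the output is empty and register `0` holds `0` (no solution is given the length `-1`). -/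
def IsAnswer {α : Type*} (A B P : List α) (τ : State α) : Prop :=
  (IsSTRICLCS A B P τ.out ∧ τ.reg 0 = τ.out.length + 1) ∨
    ((∀ Z : List α, ¬ IsFeasible A B P Z) ∧ τ.out = [] ∧ τ.reg 0 = 0)

/-- On the machine with `w`-bit words, the program `p` solves the STR-IC-LCS problem for the
strings `A`, `B`, `P` in time at most `T` and working space at most `S`, where the working space
is counted in words and consists of the working memory and the registers. -/
def SolvesWithin {α : Type*} (p : Prog) (w : ℕ) (A B P : List α) (T S : ℕ) : Prop :=
  ∃ (m t : ℕ) (τ : State α),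
    Exec w m (input A B P) p (State.init α) t τ ∧ IsAnswer A B P τ ∧
      t ≤ T ∧ m + p.numRegs ≤ S

end StrIcLcs

/-! A feasible string has the form `X ++ P ++ Y`. Cut `A` and `B` behind the images of `X`, at
positions `i` and `j`, and embed `P` as far to the left as possible after each cut
(`append_sublist_iff_greedyRest`). The room left for `Y` is a suffix of each string that depends
only on `i`, respectively `j`. Hence the optimum is `|P|` plus the maximum, over all pairs `(i, j)`,
of an LCS length of two prefixes plus an LCS length of two suffixes (`IsFeasible.exists_splitValue`,
`isFeasible_of_isEnd`). Suffixes are treated as prefixes of the reversed strings. Quadratic time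
allows all pairs to be tried and all greedy ends to be found by naive scans.

The difficulty is space: a table `f` of LCS lengths cannot be kept whole. It satisfies `f i j ≤ min
i j` and grows by at most one per horizontal, vertical or diagonal step. Put `l = f n n` and `D = n
- l + 1`, and consider the test `s ≤ f i j`. It fails if `i < s` or `j < s`. It succeeds if `i` and
`j` are both at least `s + n - l`, because the diagonal from there to the corner gains at most `l -
s` (`IsGrid.le_of_add_le`). In all other cases row `i` or column `j` is among the `D` rows or
columns from number `s` on, and it suffices to know where that line reaches level `s`. So two halves
of `(l + 2) * D` words represent the table, and a test takes constant time (`wp_query`).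

With such tests a row is restored in linear time (`wp_fillRow`), and an optimal common subsequence
is traced back in linear time (`wp_traceBack`). The halves are filled by the usual row-by-row
recurrence with one row in memory (`wp_fillTable`), after a preliminary pass that only finds `l`.
For every `i` the search restores one row of each table and runs over all `j` (`wp_search`).

The program is verified by a weakest precondition calculus that also counts time; `exec_of_wp` is
its soundness and `wp_while` its loop rule. -/

namespace StrIcLcs

/-! ### A weakest precondition calculus with running times -/

/-- A sufficient condition for the program `p`, started in state `σ` at time `t`, to halt in a state
and at a time that satisfy `Q`; additions and multiplications must not overflow. -/
def wp {α : Type*} (w m : ℕ) (x : Inp → List α) :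
    Prog → (State α → ℕ → Prop) → State α → ℕ → Prop
  | Prog.skip, Q, σ, t => Q σ (t + 1)
  | Prog.const d c, Q, σ, t => c < 2 ^ w ∧ Q (σ.setReg d c) (t + 1)
  | Prog.copy d a, Q, σ, t => Q (σ.setReg d (σ.reg a)) (t + 1)
  | Prog.arith Arith.add d a b, Q, σ, t =>
      σ.reg a + σ.reg b < 2 ^ w ∧ Q (σ.setReg d (σ.reg a + σ.reg b)) (t + 1)
  | Prog.arith Arith.sub d a b, Q, σ, t => Q (σ.setReg d (σ.reg a - σ.reg b)) (t + 1)
  | Prog.arith Arith.mul d a b, Q, σ, t =>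
      σ.reg a * σ.reg b < 2 ^ w ∧ Q (σ.setReg d (σ.reg a * σ.reg b)) (t + 1)
  | Prog.load d a, Q, σ, t => σ.reg a < m ∧ Q (σ.setReg d (σ.mem (σ.reg a))) (t + 1)
  | Prog.store a b, Q, σ, t => σ.reg a < m ∧ Q (σ.setMem (σ.reg a) (σ.reg b)) (t + 1)
  | Prog.len d u, Q, σ, t => (x u).length < 2 ^ w ∧ Q (σ.setReg d (x u).length) (t + 1)
  | Prog.emit u a, Q, σ, t => σ.reg a < (x u).length ∧
      Q { σ with out := σ.out ++ ((x u)[σ.reg a]?).toList } (t + 1)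
  | Prog.seq p q, Q, σ, t => wp w m x p (wp w m x q Q) σ t
  | Prog.branch (Test.lt a b) p q, Q, σ, t =>
      (σ.reg a < σ.reg b → wp w m x p Q σ (t + 1)) ∧
        (¬ σ.reg a < σ.reg b → wp w m x q Q σ (t + 1))
  | Prog.branch (Test.eq a b) p q, Q, σ, t =>
      (σ.reg a = σ.reg b → wp w m x p Q σ (t + 1)) ∧
        (¬ σ.reg a = σ.reg b → wp w m x q Q σ (t + 1))
  | Prog.branch (Test.sym u a v b) p q, Q, σ, t =>
      σ.reg a < (x u).length ∧ σ.reg b < (x v).length ∧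
      ((x u)[σ.reg a]? = (x v)[σ.reg b]? → wp w m x p Q σ (t + 1)) ∧
        (¬ (x u)[σ.reg a]? = (x v)[σ.reg b]? → wp w m x q Q σ (t + 1))
  | Prog.loop b p, Q, σ, t => ∃ s τ, Exec w m x (Prog.loop b p) σ s τ ∧ Q τ (t + s)

/-! ### Rewriting rules for instructions, tests and state updates. -/

section rules

variable {α : Type*} {w m : ℕ} {x : Inp → List α} {Q : State α → ℕ → Prop} {σ : State α}
  {t : ℕ}

@[simp] theorem wp_skip : wp w m x Prog.skip Q σ t = Q σ (t + 1) := by rw [wp]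
@[simp] theorem wp_const {d c : ℕ} :
    wp w m x (Prog.const d c) Q σ t = (c < 2 ^ w ∧ Q (σ.setReg d c) (t + 1)) := by rw [wp]
@[simp] theorem wp_copy {d a : ℕ} :
    wp w m x (Prog.copy d a) Q σ t = Q (σ.setReg d (σ.reg a)) (t + 1) := by rw [wp]
@[simp] theorem wp_add {d a b : ℕ} : wp w m x (Prog.arith Arith.add d a b) Q σ t =
    (σ.reg a + σ.reg b < 2 ^ w ∧ Q (σ.setReg d (σ.reg a + σ.reg b)) (t + 1)) := by rw [wp]
@[simp] theorem wp_sub {d a b : ℕ} : wp w m x (Prog.arith Arith.sub d a b) Q σ t =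
    Q (σ.setReg d (σ.reg a - σ.reg b)) (t + 1) := by rw [wp]
@[simp] theorem wp_mul {d a b : ℕ} : wp w m x (Prog.arith Arith.mul d a b) Q σ t =
    (σ.reg a * σ.reg b < 2 ^ w ∧ Q (σ.setReg d (σ.reg a * σ.reg b)) (t + 1)) := by rw [wp]
@[simp] theorem wp_load {d a : ℕ} : wp w m x (Prog.load d a) Q σ t =
    (σ.reg a < m ∧ Q (σ.setReg d (σ.mem (σ.reg a))) (t + 1)) := by rw [wp]
@[simp] theorem wp_store {a b : ℕ} : wp w m x (Prog.store a b) Q σ t =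
    (σ.reg a < m ∧ Q (σ.setMem (σ.reg a) (σ.reg b)) (t + 1)) := by rw [wp]
@[simp] theorem wp_len {d : ℕ} {u : Inp} : wp w m x (Prog.len d u) Q σ t =
    ((x u).length < 2 ^ w ∧ Q (σ.setReg d (x u).length) (t + 1)) := by rw [wp]
@[simp] theorem wp_emit {u : Inp} {a : ℕ} : wp w m x (Prog.emit u a) Q σ t =
    (σ.reg a < (x u).length ∧
      Q { σ with out := σ.out ++ ((x u)[σ.reg a]?).toList } (t + 1)) := by rw [wp]
@[simp] theorem wp_seq {p q : Prog} :
    wp w m x (Prog.seq p q) Q σ t = wp w m x p (wp w m x q Q) σ t := by rw [wp]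
@[simp] theorem wp_branch_lt {a b : ℕ} {p q : Prog} :
    wp w m x (Prog.branch (Test.lt a b) p q) Q σ t =
    ((σ.reg a < σ.reg b → wp w m x p Q σ (t + 1)) ∧
        (¬ σ.reg a < σ.reg b → wp w m x q Q σ (t + 1))) := by rw [wp]
@[simp] theorem wp_branch_eq {a b : ℕ} {p q : Prog} :
    wp w m x (Prog.branch (Test.eq a b) p q) Q σ t =
    ((σ.reg a = σ.reg b → wp w m x p Q σ (t + 1)) ∧
        (¬ σ.reg a = σ.reg b → wp w m x q Q σ (t + 1))) := by rw [wp]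
@[simp] theorem wp_branch_sym {a b : ℕ} {u v : Inp} {p q : Prog} :
    wp w m x (Prog.branch (Test.sym u a v b) p q) Q σ t =
    (σ.reg a < (x u).length ∧ σ.reg b < (x v).length ∧
      ((x u)[σ.reg a]? = (x v)[σ.reg b]? → wp w m x p Q σ (t + 1)) ∧
        (¬ (x u)[σ.reg a]? = (x v)[σ.reg b]? → wp w m x q Q σ (t + 1))) := by rw [wp]

theorem wp_loop {b : Test} {p : Prog} : wp w m x (Prog.loop b p) Q σ t =
    ∃ s τ, Exec w m x (Prog.loop b p) σ s τ ∧ Q τ (t + s) := by rw [wp]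

@[simp] theorem reg_setReg (d v r : ℕ) :
    (σ.setReg d v).reg r = if r = d then v else σ.reg r := by
  simp [State.setReg, Function.update_apply]
@[simp] theorem mem_setReg (d v : ℕ) : (σ.setReg d v).mem = σ.mem := rfl
@[simp] theorem out_setReg (d v : ℕ) : (σ.setReg d v).out = σ.out := rfl
@[simp] theorem reg_setMem (d v : ℕ) : (σ.setMem d v).reg = σ.reg := rfl
@[simp] theorem mem_setMem (d v : ℕ) : (σ.setMem d v).mem = Function.update σ.mem d v := rfl

end rules

/-- Soundness of the calculus. The overflow conditions in `wp` make the reductions modulo `2 ^ w`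
disappear, and for a loop `wp` already contains an execution. -/
theorem exec_of_wp {α : Type*} {w m : ℕ} {x : Inp → List α} {p : Prog} {Q : State α → ℕ → Prop}
    {σ : State α} {t : ℕ} (h : wp w m x p Q σ t) :
    ∃ s τ, Exec w m x p σ s τ ∧ Q τ (t + s) := by
  induction p generalizing Q σ t with
  | skip => exact ⟨_, _, Exec.skip σ, by simpa using h⟩
  | const d c =>
    obtain ⟨h1, h2⟩ := by simpa using h
    exact ⟨_, _, Exec.const σ d c, by rwa [Nat.mod_eq_of_lt h1]⟩
  | copy d a => exact ⟨_, _, Exec.copy σ d a, by simpa using h⟩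
  | arith f d a b =>
    refine ⟨_, _, Exec.arith σ f d a b, ?_⟩
    cases f with
    | add => simp only [wp_add] at h; simpa [Arith.eval, Nat.mod_eq_of_lt h.1] using h.2
    | sub => simpa [Arith.eval] using h
    | mul => simp only [wp_mul] at h; simpa [Arith.eval, Nat.mod_eq_of_lt h.1] using h.2
  | load d a => simp only [wp_load] at h; exact ⟨_, _, Exec.load σ d a h.1, h.2⟩
  | store a b => simp only [wp_store] at h; exact ⟨_, _, Exec.store σ a b h.1, h.2⟩
  | len d u =>
    simp only [wp_len] at h
    exact ⟨_, _, Exec.len σ d u, by rw [Nat.mod_eq_of_lt h.1]; exact h.2⟩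
  | emit u a =>
    simp only [wp_emit] at h
    refine ⟨_, _, Exec.emit σ u a h.1, ?_⟩
    simpa [List.getElem?_eq_getElem h.1] using h.2
  | seq p q ihp ihq =>
    simp only [wp_seq] at h
    obtain ⟨s, ρ, h1, h2⟩ := ihp h
    obtain ⟨s', τ, h3, h4⟩ := ihq h2
    exact ⟨_, _, Exec.seq h1 h3, by rwa [← Nat.add_assoc]⟩
  | branch b p q ihp ihq =>
    cases b with
    | lt a b =>
      simp only [wp_branch_lt] at h
      by_cases hc : σ.reg a < σ.reg b
      · obtain ⟨s, τ, h1, h2⟩ := ihp (h.1 hc)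
        exact ⟨_, _, Exec.branch_true (Test.Eval.lt a b) hc h1, by rwa [← Nat.add_assoc]⟩
      · obtain ⟨s, τ, h1, h2⟩ := ihq (h.2 hc)
        exact ⟨_, _, Exec.branch_false (Test.Eval.lt a b) hc h1, by rwa [← Nat.add_assoc]⟩
    | eq a b =>
      simp only [wp_branch_eq] at h
      by_cases hc : σ.reg a = σ.reg b
      · obtain ⟨s, τ, h1, h2⟩ := ihp (h.1 hc)
        exact ⟨_, _, Exec.branch_true (Test.Eval.eq a b) hc h1, by rwa [← Nat.add_assoc]⟩
      · obtain ⟨s, τ, h1, h2⟩ := ihq (h.2 hc)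
        exact ⟨_, _, Exec.branch_false (Test.Eval.eq a b) hc h1, by rwa [← Nat.add_assoc]⟩
    | sym u a v b =>
      simp only [wp_branch_sym] at h
      obtain ⟨ha, hb, h⟩ := h
      simp only [List.getElem?_eq_getElem ha, List.getElem?_eq_getElem hb,
        Option.some.injEq] at h
      by_cases hc : (x u)[σ.reg a] = (x v)[σ.reg b]
      · obtain ⟨s, τ, h1, h2⟩ := ihp (h.1 hc)
        exact ⟨_, _, Exec.branch_true (Test.Eval.sym u a v b ha hb) hc h1,
          by rwa [← Nat.add_assoc]⟩
      · obtain ⟨s, τ, h1, h2⟩ := ihq (h.2 hc)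
        exact ⟨_, _, Exec.branch_false (Test.Eval.sym u a v b ha hb) hc h1,
          by rwa [← Nat.add_assoc]⟩
  | loop b p _ => rwa [wp_loop] at h

/-- The program does not write to register `r`. -/
def Prog.keeps (r : ℕ) : Prog → Bool
  | Prog.skip => true
  | Prog.const d _ => r != d
  | Prog.copy d _ => r != d
  | Prog.arith _ d _ _ => r != d
  | Prog.load d _ => r != d
  | Prog.store _ _ => true
  | Prog.len d _ => r != d
  | Prog.emit _ _ => true
  | Prog.seq p q => p.keeps r && q.keeps r
  | Prog.branch _ p q => p.keeps r && q.keeps r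
  | Prog.loop _ p => p.keeps r

/-- The program does not write to the output. -/
def Prog.quiet : Prog → Bool
  | Prog.emit _ _ => false
  | Prog.seq p q => p.quiet && q.quiet
  | Prog.branch _ p q => p.quiet && q.quiet
  | Prog.loop _ p => p.quiet
  | _ => true

/-- The part of the state that `p` does not touch for syntactic reasons agrees in `σ` and `τ`. -/
def Frame {α : Type*} (p : Prog) (σ τ : State α) : Prop :=
  (∀ r, p.keeps r = true → τ.reg r = σ.reg r) ∧ (p.quiet = true → τ.out = σ.out)

theorem Frame.refl {α : Type*} (p : Prog) (σ : State α) : Frame p σ σ :=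
  ⟨fun _ _ => rfl, fun _ => rfl⟩

theorem Frame.trans {α : Type*} {p : Prog} {σ ρ τ : State α} (h : Frame p σ ρ)
    (h' : Frame p ρ τ) : Frame p σ τ :=
  ⟨fun r hr => (h'.1 r hr).trans (h.1 r hr), fun hr => (h'.2 hr).trans (h.2 hr)⟩

/-- Since `keeps` and `quiet` are computable, the preservation of a register or of the output by a
concrete program is later settled by evaluation (`rfl`). -/
theorem Exec.frame {α : Type*} {w m : ℕ} {x : Inp → List α} {p : Prog} {σ τ : State α} {t : ℕ}
    (h : Exec w m x p σ t τ) : Frame p σ τ := by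
  induction h with
  | skip | store => exact ⟨fun _ _ => rfl, fun _ => rfl⟩
  | emit => exact ⟨fun _ _ => rfl, fun h => by simp [Prog.quiet] at h⟩
  | const | copy | arith | load | len =>
    refine ⟨fun r hr => ?_, fun _ => rfl⟩
    simp only [Prog.keeps, bne_iff_ne] at hr
    simp [hr]
  | seq _ _ ih1 ih2 =>
    refine ⟨fun r hr => ?_, fun hr => ?_⟩
    · simp only [Prog.keeps, Bool.and_eq_true] at hr
      exact (ih2.1 r hr.2).trans (ih1.1 r hr.1)
    · simp only [Prog.quiet, Bool.and_eq_true] at hr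
      exact (ih2.2 hr.2).trans (ih1.2 hr.1)
  | branch_true _ _ _ ih =>
    refine ⟨fun r hr => ?_, fun hr => ?_⟩
    · simp only [Prog.keeps, Bool.and_eq_true] at hr
      exact ih.1 r hr.1
    · simp only [Prog.quiet, Bool.and_eq_true] at hr
      exact ih.2 hr.1
  | branch_false _ _ _ ih =>
    refine ⟨fun r hr => ?_, fun hr => ?_⟩
    · simp only [Prog.keeps, Bool.and_eq_true] at hr
      exact ih.1 r hr.2
    · simp only [Prog.quiet, Bool.and_eq_true] at hr
      exact ih.2 hr.2
  | loop_true _ _ _ _ ih1 ih2 =>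
    refine ⟨fun r hr => ?_, fun hr => ?_⟩
    · exact (ih2.1 r hr).trans (ih1.1 r hr)
    · exact (ih2.2 hr).trans (ih1.2 hr)
  | loop_false => exact ⟨fun _ _ => rfl, fun _ => rfl⟩

theorem wp_mono {α : Type*} {w m : ℕ} {x : Inp → List α} {p : Prog}
    {Q Q' : State α → ℕ → Prop} {σ : State α} {t : ℕ} (h : wp w m x p Q' σ t)
    (hQ : ∀ τ t', Q' τ t' → Q τ t') : wp w m x p Q σ t := by
  induction p generalizing Q Q' σ t with
  | skip => simpa using hQ _ _ (by simpa using h)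
  | const | load | store | len | emit =>
    simp at h ⊢; exact ⟨h.1, hQ _ _ h.2⟩
  | copy => simp at h ⊢; exact hQ _ _ h
  | arith f d a b =>
    cases f with
    | add | mul => simp at h ⊢; exact ⟨h.1, hQ _ _ h.2⟩
    | sub => simp at h ⊢; exact hQ _ _ h
  | seq p q ihp ihq =>
    simp only [wp_seq] at h ⊢
    exact ihp h fun τ t' h' => ihq h' hQ
  | branch b p q ihp ihq =>
    cases b with
    | lt | eq =>
      simp only [wp_branch_lt, wp_branch_eq] at h ⊢
      exact ⟨fun hc => ihp (h.1 hc) hQ, fun hc => ihq (h.2 hc) hQ⟩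
    | sym =>
      simp only [wp_branch_sym] at h ⊢
      exact ⟨h.1, h.2.1, fun hc => ihp (h.2.2.1 hc) hQ, fun hc => ihq (h.2.2.2 hc) hQ⟩
  | loop b p =>
    rw [wp_loop] at h ⊢
    obtain ⟨s, τ, h1, h2⟩ := h
    exact ⟨s, τ, h1, hQ _ _ h2⟩

theorem Frame.seq {α : Type*} {p q : Prog} {σ ρ τ : State α} (h : Frame p σ ρ)
    (h' : Frame q ρ τ) : Frame (Prog.seq p q) σ τ := by
  refine ⟨fun r hr => ?_, fun hr => ?_⟩
  · simp only [Prog.keeps, Bool.and_eq_true] at hr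
    exact (h'.1 r hr.2).trans (h.1 r hr.1)
  · simp only [Prog.quiet, Bool.and_eq_true] at hr
    exact (h'.2 hr.2).trans (h.2 hr.1)

theorem Frame.branch {α : Type*} {b : Test} {p q : Prog} {σ τ : State α}
    (h : Frame p σ τ ∨ Frame q σ τ) : Frame (Prog.branch b p q) σ τ := by
  refine ⟨fun r hr => ?_, fun hr => ?_⟩
  · simp only [Prog.keeps, Bool.and_eq_true] at hr
    exact h.elim (fun h => h.1 r hr.1) (fun h => h.1 r hr.2)
  · simp only [Prog.quiet, Bool.and_eq_true] at hr
    exact h.elim (fun h => h.2 hr.1) (fun h => h.2 hr.2)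

theorem Frame.setReg {α : Type*} {p : Prog} {σ : State α} {d v : ℕ} (h : p.keeps d = false) :
    Frame p σ (σ.setReg d v) := by
  refine ⟨fun r hr => ?_, fun _ => rfl⟩
  have : r ≠ d := by rintro rfl; simp [h] at hr
  simp [this]

theorem wp_frame {α : Type*} {w m : ℕ} {x : Inp → List α} {p : Prog}
    {Q : State α → ℕ → Prop} {σ : State α} {t : ℕ} (h : wp w m x p Q σ t) :
    wp w m x p (fun τ t' => Q τ t' ∧ Frame p σ τ) σ t := by
  induction p generalizing Q σ t with
  | skip => simpa [Frame.refl] using h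
  | const | load | len =>
    simp only [wp_const, wp_load, wp_len] at h ⊢
    exact ⟨h.1, h.2, Frame.setReg (by simp [Prog.keeps])⟩
  | store a b => simp only [wp_store] at h ⊢; exact ⟨h.1, h.2, fun _ _ => rfl, fun _ => rfl⟩
  | emit => simp only [wp_emit] at h ⊢; exact ⟨h.1, h.2, fun _ _ => rfl, by simp [Prog.quiet]⟩
  | copy => simp only [wp_copy] at h ⊢; exact ⟨h, Frame.setReg (by simp [Prog.keeps])⟩
  | arith f d a b =>
    cases f with
    | add | mul =>
      simp only [wp_add, wp_mul] at h ⊢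
      exact ⟨h.1, h.2, Frame.setReg (by simp [Prog.keeps])⟩
    | sub => simp only [wp_sub] at h ⊢; exact ⟨h, Frame.setReg (by simp [Prog.keeps])⟩
  | seq p q ihp ihq =>
    simp only [wp_seq] at h ⊢
    exact wp_mono (ihp h) fun τ t' h' => wp_mono (ihq h'.1) fun τ' t'' h'' =>
      ⟨h''.1, h'.2.seq h''.2⟩
  | branch b p q ihp ihq =>
    have hp : ∀ {t}, wp w m x p Q σ t →
        wp w m x p (fun τ t' => Q τ t' ∧ Frame (Prog.branch b p q) σ τ) σ t := fun h =>
      wp_mono (ihp h) fun τ t' h' => ⟨h'.1, Frame.branch (Or.inl h'.2)⟩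
    have hq : ∀ {t}, wp w m x q Q σ t →
        wp w m x q (fun τ t' => Q τ t' ∧ Frame (Prog.branch b p q) σ τ) σ t := fun h =>
      wp_mono (ihq h) fun τ t' h' => ⟨h'.1, Frame.branch (Or.inr h'.2)⟩
    cases b with
    | lt | eq =>
      simp only [wp_branch_lt, wp_branch_eq] at h ⊢
      exact ⟨fun hc => hp (h.1 hc), fun hc => hq (h.2 hc)⟩
    | sym =>
      simp only [wp_branch_sym] at h ⊢
      exact ⟨h.1, h.2.1, fun hc => hp (h.2.2.1 hc), fun hc => hq (h.2.2.2 hc)⟩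
  | loop b p =>
    rw [wp_loop] at h ⊢
    obtain ⟨s, τ, h1, h2⟩ := h
    exact ⟨s, τ, h1, h2, h1.frame⟩

/-- The form in which subprograms are called: a specification mentions only what changes, and
everything else is supplied by the frame. -/
theorem wp_conseq {α : Type*} {w m : ℕ} {x : Inp → List α} {p : Prog}
    {Q Q' : State α → ℕ → Prop} {σ : State α} {t : ℕ} (h : wp w m x p Q' σ t)
    (hQ : ∀ τ t', Frame p σ τ → Q' τ t' → Q τ t') : wp w m x p Q σ t :=
  wp_mono (wp_frame h) fun τ t' h => hQ τ t' h.2 h.1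

/-- The variant `V` bounds the number of rounds. A round costs at most `c` and one unit for its
test; the last unit is the failing test. As `step` holds for every starting time, the invariant need
not speak of time. -/
theorem wp_while {α : Type*} {w m : ℕ} {x : Inp → List α} {a b : ℕ} {p : Prog}
    {Q : State α → ℕ → Prop} {σ : State α} {t : ℕ} (c : ℕ) (I : State α → Prop)
    (V : State α → ℕ) (h0 : I σ)
    (step : ∀ ρ s, Frame p σ ρ → I ρ → ρ.reg a < ρ.reg b →
      wp w m x p (fun τ s' => s' ≤ s + c ∧ V τ < V ρ ∧ I τ) ρ s)
    (fin : ∀ ρ s, Frame p σ ρ → I ρ → ¬ ρ.reg a < ρ.reg b → s ≤ t + V σ * (c + 1) + 1 → Q ρ s) :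
    wp w m x (Prog.loop (Test.lt a b) p) Q σ t := by
  have key : ∀ N ρ s, Frame p σ ρ → I ρ → V ρ = N → ∃ s' τ,
      Exec w m x (Prog.loop (Test.lt a b) p) ρ s' τ ∧ Frame p σ τ ∧ I τ ∧
      ¬ τ.reg a < τ.reg b ∧ s + s' ≤ s + N * (c + 1) + 1 := by
    intro N
    induction N using Nat.strong_induction_on with
    | _ N ih =>
      intro ρ s hf hI hV
      by_cases hc : ρ.reg a < ρ.reg b
      · obtain ⟨s1, τ1, e1, h1, h2, h3⟩ := exec_of_wp (step ρ s hf hI hc)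
        obtain ⟨s2, τ2, e2, hf2, hI2, hc2, ht2⟩ :=
          ih (V τ1) (by omega) τ1 s (hf.trans e1.frame) h3 rfl
        refine ⟨_, τ2, Exec.loop_true (Test.Eval.lt a b) hc e1 e2, hf2, hI2, hc2, ?_⟩
        have : (V τ1 + 1) * (c + 1) ≤ N * (c + 1) := Nat.mul_le_mul_right _ (by omega)
        rw [Nat.add_mul] at this
        omega
      · exact ⟨1, ρ, Exec.loop_false (Test.Eval.lt a b) hc, hf, hI, hc, by omega⟩
  obtain ⟨s, τ, h1, h2, h3, h4, h5⟩ := key _ σ t (Frame.refl p σ) h0 rfl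
  rw [wp_loop]
  exact ⟨s, τ, h1, fin _ _ h2 h3 h4 h5⟩

/-- The rule for a loop in which register `a` counts from `i₀` up to the value `N` of the
register `b`. -/
theorem wp_for {α : Type*} {w m : ℕ} {x : Inp → List α} {a b : ℕ} {p : Prog}
    {Q : State α → ℕ → Prop} {σ : State α} {t : ℕ} (c i₀ N : ℕ) (I : ℕ → State α → Prop)
    (ha : σ.reg a = i₀) (hb : σ.reg b = N) (hN : i₀ ≤ N) (hk : p.keeps b = true) (h0 : I i₀ σ)
    (step : ∀ i ρ s, Frame p σ ρ → i₀ ≤ i → i < N → ρ.reg a = i → I i ρ →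
      wp w m x p (fun τ s' => s' ≤ s + c ∧ τ.reg a = i + 1 ∧ I (i + 1) τ) ρ s)
    (fin : ∀ ρ s, Frame p σ ρ → ρ.reg a = N → I N ρ → s ≤ t + (N - i₀) * (c + 1) + 1 → Q ρ s) :
    wp w m x (Prog.loop (Test.lt a b) p) Q σ t := by
  refine wp_while c (fun ρ => i₀ ≤ ρ.reg a ∧ ρ.reg a ≤ N ∧ I (ρ.reg a) ρ)
    (fun ρ => N - ρ.reg a) ⟨by omega, by omega, by rwa [ha]⟩ ?_ ?_
  · rintro ρ s hf ⟨h1, h2, h3⟩ hc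
    rw [hf.1 b hk, hb] at hc
    refine wp_mono (step _ ρ s hf h1 hc rfl h3) ?_
    rintro τ t' ⟨g1, g2, g3⟩
    rw [← g2] at g3
    exact ⟨g1, by omega, by omega, by omega, g3⟩
  · rintro ρ s hf ⟨h1, h2, h3⟩ hc hs
    rw [hf.1 b hk, hb] at hc
    have : ρ.reg a = N := by omega
    rw [this] at h3
    rw [ha] at hs
    exact fin ρ s hf this h3 hs

/-! ### The table of the lengths of longest common subsequences of prefixes -/

open Classical in
/-- The usual recurrence for the lengths of the longest common subsequences of the prefixes of `U`
and `V`. -/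
noncomputable def prefixLcs {α : Type*} (U V : List α) : ℕ → ℕ → ℕ
  | 0, _ => 0
  | _ + 1, 0 => 0
  | i + 1, j + 1 =>
    if U[i]? = V[j]? then prefixLcs U V i j + 1
    else max (prefixLcs U V i (j + 1)) (prefixLcs U V (i + 1) j)
  termination_by i j => (i, j)

/-- The monotonicity properties of tables of lengths of longest common subsequences. -/
structure IsGrid (f : ℕ → ℕ → ℕ) : Prop where
  zero_left : ∀ j, f 0 j = 0
  zero_right : ∀ i, f i 0 = 0
  mono_left : ∀ i j, f i j ≤ f (i + 1) j
  mono_right : ∀ i j, f i j ≤ f i (j + 1)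
  step_left : ∀ i j, f (i + 1) j ≤ f i j + 1
  step_right : ∀ i j, f i (j + 1) ≤ f i j + 1
  step_diag : ∀ i j, f (i + 1) (j + 1) ≤ f i j + 1

theorem prefixLcs_zero_left {α : Type*} (U V : List α) (j : ℕ) : prefixLcs U V 0 j = 0 := by
  rw [prefixLcs]

theorem prefixLcs_zero_right {α : Type*} (U V : List α) (i : ℕ) : prefixLcs U V i 0 = 0 := by
  cases i <;> rw [prefixLcs]

theorem prefixLcs_of_eq {α : Type*} {U V : List α} {i j : ℕ} (h : U[i]? = V[j]?) :
    prefixLcs U V (i + 1) (j + 1) = prefixLcs U V i j + 1 := by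
  rw [prefixLcs, if_pos h]

theorem prefixLcs_of_ne {α : Type*} {U V : List α} {i j : ℕ} (h : ¬ U[i]? = V[j]?) :
    prefixLcs U V (i + 1) (j + 1) =
      max (prefixLcs U V i (j + 1)) (prefixLcs U V (i + 1) j) := by
  rw [prefixLcs, if_neg h]

/-- The inequalities follow from the recurrence alone, so they persist beyond the ends of the
strings, where `none = none` counts as a match. The four one-step bounds are proved together by
induction on `i + j`, because a row step at `(i, j + 1)` uses row and column steps at `(i, j)`. -/
theorem isGrid_prefixLcs {α : Type*} (U V : List α) : IsGrid (prefixLcs U V) := by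
  have key : ∀ N i j, i + j = N →
      prefixLcs U V i j ≤ prefixLcs U V (i + 1) j ∧ prefixLcs U V i j ≤ prefixLcs U V i (j + 1) ∧
      prefixLcs U V (i + 1) j ≤ prefixLcs U V i j + 1 ∧
      prefixLcs U V i (j + 1) ≤ prefixLcs U V i j + 1 := by
    intro N
    induction N using Nat.strong_induction_on with
    | _ N ih =>
      intro i j hN
      have h1 : prefixLcs U V i j ≤ prefixLcs U V (i + 1) j ∧
          prefixLcs U V (i + 1) j ≤ prefixLcs U V i j + 1 := by
        cases j with
        | zero => simp [prefixLcs_zero_right]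
        | succ j =>
          obtain ⟨h1, h2, h3, h4⟩ := ih (i + j) (by omega) i j rfl
          by_cases h : U[i]? = V[j]?
          · rw [prefixLcs_of_eq h]; omega
          · rw [prefixLcs_of_ne h]; omega
      have h2 : prefixLcs U V i j ≤ prefixLcs U V i (j + 1) ∧
          prefixLcs U V i (j + 1) ≤ prefixLcs U V i j + 1 := by
        cases i with
        | zero => simp [prefixLcs_zero_left]
        | succ i =>
          obtain ⟨h1, h2, h3, h4⟩ := ih (i + j) (by omega) i j rfl
          by_cases h : U[i]? = V[j]?
          · rw [prefixLcs_of_eq h]; omega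
          · rw [prefixLcs_of_ne h]; omega
      exact ⟨h1.1, h2.1, h1.2, h2.2⟩
  refine ⟨prefixLcs_zero_left U V, prefixLcs_zero_right U V, fun i j => (key _ i j rfl).1,
    fun i j => (key _ i j rfl).2.1, fun i j => (key _ i j rfl).2.2.1,
    fun i j => (key _ i j rfl).2.2.2, fun i j => ?_⟩
  have := key _ i j rfl
  by_cases h : U[i]? = V[j]?
  · rw [prefixLcs_of_eq h]
  · rw [prefixLcs_of_ne h]; omega

/-! ### Consequences of the grid inequalities. -/

namespace IsGrid

variable {f : ℕ → ℕ → ℕ}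

theorem swap (hf : IsGrid f) : IsGrid fun i j => f j i :=
  ⟨hf.zero_right, hf.zero_left, fun i j => hf.mono_right j i, fun i j => hf.mono_left j i,
    fun i j => hf.step_right j i, fun i j => hf.step_left j i, fun i j => hf.step_diag j i⟩

theorem le_of_le_left (hf : IsGrid f) {i i' : ℕ} (j : ℕ) (h : i ≤ i') : f i j ≤ f i' j :=
  monotone_nat_of_le_succ (fun i => hf.mono_left i j) h

theorem le_of_le_right (hf : IsGrid f) (i : ℕ) {j j' : ℕ} (h : j ≤ j') : f i j ≤ f i j' :=
  monotone_nat_of_le_succ (fun j => hf.mono_right i j) h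

theorem le_left (hf : IsGrid f) (i j : ℕ) : f i j ≤ i := by
  induction i with
  | zero => simp [hf.zero_left]
  | succ i ih => have := hf.step_left i j; omega

theorem le_right (hf : IsGrid f) (i j : ℕ) : f i j ≤ j := hf.swap.le_left j i

theorem le_diag_add (hf : IsGrid f) (i k : ℕ) : f (i + k) (i + k) ≤ f i i + k := by
  induction k with
  | zero => simp
  | succ k ih => have := hf.step_diag (i + k) (i + k); simp only [← Nat.add_assoc]; omega

/-- Far from the borders, the entries of the table are as large as needed. -/
theorem le_of_add_le (hf : IsGrid f) {n s i j : ℕ} (hs : s ≤ f n n) (hi : s + n ≤ i + f n n)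
    (hj : s + n ≤ j + f n n) : s ≤ f i j := by
  have hn := hf.le_left n n
  -- The diagonal point with coordinates `s + n - f n n` is `f n n - s` diagonal steps before the
  -- corner, and each step gains at most one; its entry is therefore at least `s`.
  have h := hf.le_diag_add (s + n - f n n) (f n n - s)
  rw [show s + n - f n n + (f n n - s) = n by omega] at h
  have h1 := hf.le_of_le_left (i := s + n - f n n) (i' := i) (s + n - f n n) (by omega)
  have h2 := hf.le_of_le_right i (j := s + n - f n n) (j' := j) (by omega)
  omega

end IsGrid

/-- The recurrence compares last symbols, whereas `List.Sublist` peels off first ones; reversal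
translates between the two. -/
theorem append_singleton_sublist {α : Type*} {Z U : List α} {c a : α} :
    List.Sublist (Z ++ [c]) (U ++ [a]) ↔
      List.Sublist (Z ++ [c]) U ∨ (c = a ∧ List.Sublist Z U) := by
  rw [← List.reverse_sublist, ← List.reverse_sublist (l₂ := U), ← List.reverse_sublist (l₁ := Z)]
  simp only [List.reverse_append, List.reverse_cons, List.reverse_nil, List.nil_append,
    List.cons_append]
  constructor
  · intro h
    cases h with
    | cons _ h => exact Or.inl h
    | cons_cons _ h => exact Or.inr ⟨rfl, h⟩
  · rintro (h | ⟨rfl, h⟩)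
    · exact h.cons _
    · exact h.cons_cons _

/-- If one of the two embeddings avoids the last symbol of its prefix, that prefix can be shortened.
If both use it, the last symbols agree and the matching case of the recurrence applies. -/
theorem length_le_prefixLcs {α : Type*} (U V : List α) {i j : ℕ} (hi : i ≤ U.length)
    (hj : j ≤ V.length) {Z : List α} (hU : List.Sublist Z (U.take i))
    (hV : List.Sublist Z (V.take j)) : Z.length ≤ prefixLcs U V i j := by
  induction h : i + j using Nat.strong_induction_on generalizing i j Z with
  | _ N ih =>
    rcases List.eq_nil_or_concat Z with rfl | ⟨Z, c, rfl⟩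
    · simp
    · rw [List.concat_eq_append] at *
      cases i with
      | zero => simp at hU
      | succ i =>
        cases j with
        | zero => simp at hV
        | succ j =>
          have hU' := hU
          have hV' := hV
          rw [List.take_add_one, List.getElem?_eq_getElem hi, Option.toList_some,
            append_singleton_sublist] at hU'
          rw [List.take_add_one, List.getElem?_eq_getElem hj, Option.toList_some,
            append_singleton_sublist] at hV'
          have hg := isGrid_prefixLcs U V
          rcases hU' with hU' | ⟨rfl, hU'⟩
          · exact (ih _ (by omega) (by omega) hj hU' hV rfl).trans (hg.mono_left _ _)
          · rcases hV' with hV' | ⟨hc, hV'⟩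
            · exact (ih _ (by omega) hi (by omega) hU hV' rfl).trans (hg.mono_right _ _)
            · have := ih _ (by omega) (by omega) (by omega) hU' hV' rfl
              rw [prefixLcs_of_eq (by
                rw [List.getElem?_eq_getElem hi, List.getElem?_eq_getElem hj, hc])]
              simpa using this

theorem exists_prefixLcs {α : Type*} (U V : List α) {i j : ℕ} (hi : i ≤ U.length)
    (hj : j ≤ V.length) : ∃ Z, List.Sublist Z (U.take i) ∧ List.Sublist Z (V.take j) ∧
      Z.length = prefixLcs U V i j := by
  induction h : i + j using Nat.strong_induction_on generalizing i j with
  | _ N ih =>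
    cases i with
    | zero => exact ⟨[], by simp, by simp, by simp [prefixLcs_zero_left]⟩
    | succ i =>
      cases j with
      | zero => exact ⟨[], by simp, by simp, by simp [prefixLcs_zero_right]⟩
      | succ j =>
        have mU : List.Sublist (U.take i) (U.take (i + 1)) := List.take_sublist_take_left (by omega)
        have mV : List.Sublist (V.take j) (V.take (j + 1)) := List.take_sublist_take_left (by omega)
        by_cases he : U[i]? = V[j]?
        · obtain ⟨Z, h1, h2, h3⟩ := ih _ (by omega) (i := i) (j := j) (by omega) (by omega) rfl
          refine ⟨Z ++ (U[i]?).toList, ?_, ?_, ?_⟩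
          · rw [List.take_add_one]; exact h1.append_right _
          · rw [List.take_add_one, he]; exact h2.append_right _
          · rw [prefixLcs_of_eq he, List.getElem?_eq_getElem hi]; simp [h3]
        · rw [prefixLcs_of_ne he]
          rcases le_total (prefixLcs U V i (j + 1)) (prefixLcs U V (i + 1) j) with hc | hc
          · obtain ⟨Z, h1, h2, h3⟩ := ih _ (by omega) (i := i + 1) (j := j) hi (by omega) rfl
            exact ⟨Z, h1, h2.trans mV, by rw [h3, max_eq_right hc]⟩
          · obtain ⟨Z, h1, h2, h3⟩ := ih _ (by omega) (i := i) (j := j + 1) (by omega) hj rfl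
            exact ⟨Z, h1.trans mU, h2, by rw [h3, max_eq_left hc]⟩

theorem lcs_eq_prefixLcs {α : Type*} {n : ℕ} {A B : List α} (hA : A.length = n)
    (hB : B.length = n) : lcs A B = prefixLcs A B n n := by
  obtain ⟨⟨Z, hZ, hl⟩, hmax⟩ := lcs_isGreatest A B
  apply le_antisymm
  · rw [← hl]
    refine length_le_prefixLcs A B hA.ge hB.ge ?_ ?_
    · rw [← hA, List.take_length]; exact hZ.1
    · rw [← hB, List.take_length]; exact hZ.2
  · obtain ⟨Z, h1, h2, h3⟩ := exists_prefixLcs A B hA.ge hB.ge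
    exact hmax ⟨Z, ⟨h1.trans (List.take_sublist _ _), h2.trans (List.take_sublist _ _)⟩, h3⟩

/-- Gives both tables the same corner entry, so that one width `D` serves for both. -/
theorem lcs_reverse {α : Type*} (A B : List α) : lcs A.reverse B.reverse = lcs A B := by
  have key : ∀ A B : List α, lcs A.reverse B.reverse ≤ lcs A B := fun A B => by
    obtain ⟨Z, hZ, hl⟩ := (lcs_isGreatest A.reverse B.reverse).1
    refine (lcs_isGreatest A B).2 ⟨Z.reverse, ⟨?_, ?_⟩, by simpa using hl⟩
    · simpa using hZ.1.reverse
    · simpa using hZ.2.reverse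
  exact le_antisymm (key A B) (by simpa using key A.reverse B.reverse)

/-! ### Threshold tables -/

/-- The mark that the scan of the columns below `j` leaves for the level `s` of the row `g`: it is
`n - c` if `g` reaches the level `s` when passing from column `c` to `c + 1`, and `0` if `g` stays
below `s`. -/
def mark (n : ℕ) (g : ℕ → ℕ) (s : ℕ) : ℕ → ℕ
  | 0 => 0
  | j + 1 => if g j < s ∧ s = g (j + 1) then n - j else mark n g s j

/-- A mark `n - c` turns the question `s ≤ g j` into `c < j`. Marks of reached levels are positive,
so `0`, the initial content of memory, correctly stands for a level that is never reached. -/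
theorem lt_mark_add_iff {n s : ℕ} {g : ℕ → ℕ} (h0 : g 0 = 0) (mono : ∀ j, g j ≤ g (j + 1))
    (step : ∀ j, g (j + 1) ≤ g j + 1) (hs : 1 ≤ s) {j : ℕ} (hj : j ≤ n) :
    n < mark n g s n + j ↔ s ≤ g j := by
  -- The first conjunct strengthens the induction: `mark + J ≤ n` alone would not exclude `n < mark
  -- + (J + 1)` for a row that stays below `s`.
  have key : ∀ J, J ≤ n → (g J < s → mark n g s J = 0) ∧
      ∀ j, j ≤ J → (n < mark n g s J + j ↔ s ≤ g j) := by
    intro J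
    induction J with
    | zero =>
      intro _
      refine ⟨fun _ => rfl, fun j hj => ?_⟩
      obtain rfl : j = 0 := by omega
      simp only [mark, h0]; omega
    | succ J ih =>
      intro hJ
      obtain ⟨ih1, ih2⟩ := ih (by omega)
      have m1 := mono J
      have s1 := step J
      rw [mark]
      split_ifs with hc
      · refine ⟨fun h => by omega, fun j hj => ?_⟩
        rcases Nat.lt_or_ge J j with h | h
        · obtain rfl : j = J + 1 := by omega
          omega
        · have : g j ≤ g J := monotone_nat_of_le_succ mono h
          omega
      · refine ⟨fun h => ih1 (by omega), fun j hj => ?_⟩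
        rcases Nat.lt_or_ge J j with h | h
        · obtain rfl : j = J + 1 := by omega
          have := ih2 J le_rfl
          by_cases hl : g J < s
          · rw [ih1 hl]; omega
          · omega
        · exact ih2 j h
  exact (key n le_rfl).2 j hj

theorem cell_inj {D s k s' k' : ℕ} (hk : k < D) (hk' : k' < D)
    (h : s * D + k = s' * D + k') : s = s' ∧ k = k' := by
  have h1 : s = s' := by
    have := congrArg (· / D) h
    simpa [Nat.add_comm _ k, Nat.add_comm _ k', Nat.add_mul_div_right _ _ (by omega : 0 < D),
      Nat.div_eq_of_lt hk, Nat.div_eq_of_lt hk'] using this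
  subst h1
  exact ⟨rfl, by omega⟩

theorem cell_lt {D S s k : ℕ} (hk : k < D) (hS : (s + 1) * D ≤ S) : s * D + k < S := by
  rw [Nat.add_mul] at hS; omega

/-- The `S` memory cells from address `b` on hold the marks for the rows of `f`, where the row `y`
is scanned up to column `J y`. There are `D` cells for every level `s`; they are for the
rows from `s` on. -/
def Marked (n D S : ℕ) (f : ℕ → ℕ → ℕ) (J : ℕ → ℕ) (mem : ℕ → ℕ) (b : ℕ) : Prop :=
  ∀ s k, 1 ≤ s → k < D → (s + 1) * D ≤ S →
    mem (b + (s * D + k)) = mark n (f (s + k)) s (J (s + k))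

theorem Marked.congr {n D S : ℕ} {f : ℕ → ℕ → ℕ} {J J' : ℕ → ℕ} {mem mem' : ℕ → ℕ} {b : ℕ}
    (h : Marked n D S f J mem b) (hJ : ∀ y, 1 ≤ y → J' y = J y)
    (hm : ∀ a, b ≤ a → a < b + S → mem' a = mem a) : Marked n D S f J' mem' b := by
  intro s k hs hk hS
  have := cell_lt hk hS
  rw [hm _ (by omega) (by omega), hJ _ (by omega)]
  exact h s k hs hk hS

theorem Marked.zero {n D S : ℕ} {f : ℕ → ℕ → ℕ} {mem : ℕ → ℕ} {b : ℕ}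
    (hm : ∀ a, b ≤ a → a < b + S → mem a = 0) : Marked n D S f (fun _ => 0) mem b := by
  intro s k hs hk hS
  have := cell_lt hk hS
  rw [hm _ (by omega) (by omega), mark]

/-- One step raises the row by at most one, so only the level `f y (j + 1)` can be newly reached. If
its offset is not below `D`, there is no cell for it and nothing has to be stored; otherwise the
write hits no other cell by `cell_inj`. -/
theorem Marked.step {n D S : ℕ} {f : ℕ → ℕ → ℕ} {J J' : ℕ → ℕ} {mem : ℕ → ℕ} {b y j : ℕ}
    (hf : IsGrid f) (h : Marked n D S f J mem b) (hj : J y = j) (hj' : J' y = j + 1)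
    (hJ : ∀ z, z ≠ y → J' z = J z) :
    Marked n D S f J'
      (if f y j < f y (j + 1) ∧ y - f y (j + 1) < D then
        Function.update mem (b + (f y (j + 1) * D + (y - f y (j + 1)))) (n - j) else mem) b := by
  intro s k hs hk hS
  have hy := hf.le_left y (j + 1)
  have h1 := h s k hs hk hS
  have hst := hf.step_right y j
  by_cases hz : s + k = y
  · rw [hz, hj']
    rw [hz, hj] at h1
    rw [mark]
    by_cases hc : f y j < s ∧ s = f y (j + 1)
    · rw [if_pos hc, if_pos (by omega)]
      rw [← hc.2, show y - s = k by omega, Function.update_self]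
    · rw [if_neg hc, ← h1]
      split_ifs with hd
      · rw [Function.update_of_ne]
        intro he
        have := cell_inj hk hd.2 (Nat.add_left_cancel he)
        omega
      · rfl
  · rw [hJ _ hz, ← h1]
    split_ifs with hd
    · rw [Function.update_of_ne]
      intro he
      have := cell_inj hk hd.2 (Nat.add_left_cancel he)
      omega
    · rfl

/-- The memory cells from the addresses `b` and `b'` on represent the table `f`: they tell when the
rows and the columns of `f` reach the levels from `1` to `l + 1`. -/
structure IsTable (n l D : ℕ) (f : ℕ → ℕ → ℕ) (mem : ℕ → ℕ) (b b' : ℕ) : Prop where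
  row : ∀ s k j, 1 ≤ s → s ≤ l + 1 → k < D → s + k ≤ n → j ≤ n →
    (n < mem (b + (s * D + k)) + j ↔ s ≤ f (s + k) j)
  col : ∀ s k i, 1 ≤ s → s ≤ l + 1 → k < D → s + k ≤ n → i ≤ n →
    (n < mem (b' + (s * D + k)) + i ↔ s ≤ f i (s + k))

theorem isTable_of_marked {n l D S : ℕ} {f : ℕ → ℕ → ℕ} {J J' mem : ℕ → ℕ} {b b' : ℕ}
    (hf : IsGrid f) (hS : (l + 2) * D ≤ S) (hJ : ∀ y, 1 ≤ y → y ≤ n → J y = n)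
    (hJ' : ∀ y, 1 ≤ y → y ≤ n → J' y = n) (h : Marked n D S f J mem b)
    (h' : Marked n D S (fun i j => f j i) J' mem b') : IsTable n l D f mem b b' := by
  constructor
  · intro s k j hs hl hk hn hj
    rw [h s k hs hk ((Nat.mul_le_mul_right D (by omega)).trans hS), hJ _ (by omega) hn]
    exact lt_mark_add_iff (hf.zero_right _) (hf.mono_right _) (hf.step_right _) hs hj
  · intro s k i hs hl hk hn hi
    rw [h' s k hs hk ((Nat.mul_le_mul_right D (by omega)).trans hS), hJ' _ (by omega) hn]
    exact lt_mark_add_iff (g := fun i => f i (s + k)) (hf.zero_left _)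
      (fun i => hf.mono_left i _) (fun i => hf.step_left i _) hs hi

theorem IsTable.congr {n l D : ℕ} {f : ℕ → ℕ → ℕ} {mem mem' : ℕ → ℕ} {b b' : ℕ}
    (h : IsTable n l D f mem b b')
    (hm : ∀ a, b ≤ a → a < b + (l + 2) * D → mem' a = mem a)
    (hm' : ∀ a, b' ≤ a → a < b' + (l + 2) * D → mem' a = mem a) :
    IsTable n l D f mem' b b' := by
  have key : ∀ s k, s ≤ l + 1 → k < D → s * D + k < (l + 2) * D := fun s k hs hk =>
    cell_lt hk (Nat.mul_le_mul_right D (by omega))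
  constructor
  · intro s k j hs hl hk hn hj
    have := key s k hl hk
    rw [hm _ (by omega) (by omega)]
    exact h.row s k j hs hl hk hn hj
  · intro s k j hs hl hk hn hj
    have := key s k hl hk
    rw [hm' _ (by omega) (by omega)]
    exact h.col s k j hs hl hk hn hj

/-! ### Greedy embeddings of the pattern -/

open Classical in
/-- The rest of a string after the shortest prefix that has `P` as a subsequence. -/
noncomputable def greedyRest {α : Type*} : List α → List α → Option (List α)
  | [], U => some U
  | _ :: _, [] => none
  | a :: P, b :: U => if b = a then greedyRest P U else greedyRest (a :: P) U

/-- The exchange argument: matching the first symbol of the pattern at its first occurrence never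
hurts, as it leaves the longest rest. -/
theorem append_sublist_iff_greedyRest {α : Type*} (P U Y : List α) :
    List.Sublist (P ++ Y) U ↔ ∃ R, greedyRest P U = some R ∧ List.Sublist Y R := by
  induction U generalizing P with
  | nil =>
    cases P with
    | nil => simp [greedyRest]
    | cons a P => simp [greedyRest]
  | cons b U ih =>
    cases P with
    | nil => simp [greedyRest]
    | cons a P =>
      rw [greedyRest, List.cons_append]
      split_ifs with h
      · subst h; rw [List.cons_sublist_cons]; exact ih P
      · rw [← ih (a :: P), List.cons_append]
        constructor
        · intro h'
          cases h' with
          | cons _ h' => exact h'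
          | cons_cons _ h' => exact absurd rfl h
        · exact fun h' => h'.cons _

/-- The number `v` encodes where the leftmost embedding of `P` into the suffix of `U` from `s` on
ends: it is `0` if there is none, and otherwise one more than the length of the rest. -/
def IsEnd {α : Type*} (P U : List α) (s v : ℕ) : Prop :=
  (v = 0 ∧ greedyRest P (U.drop s) = none) ∨
    ∃ e, e ≤ U.length ∧ v = U.length + 1 - e ∧ greedyRest P (U.drop s) = some (U.drop e)

/-- The value of a pair of starting positions: `0` if there is no embedding of the pattern, and
otherwise the maximal number of symbols around the pattern, plus one. -/
def splitValue (f g : ℕ → ℕ → ℕ) (eA eB : ℕ → ℕ) (i j : ℕ) : ℕ :=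
  if eA i = 0 ∨ eB j = 0 then 0 else f i j + g (eA i - 1) (eB j - 1) + 1

/-- A nonzero `v` encodes a rest of `v - 1` symbols, and this rest is, reversed, the prefix of
length `v - 1` of `U.reverse`. -/
theorem IsEnd.append_sublist {α : Type*} {P U X Y : List α} {s v : ℕ} (h : IsEnd P U s v)
    (hv : v ≠ 0) (hX : List.Sublist X (U.take s)) (hY : List.Sublist Y (U.reverse.take (v - 1))) :
    List.Sublist (X ++ (P ++ Y.reverse)) U := by
  rcases h with h | ⟨e, he, hve, hR⟩
  · exact absurd h.1 hv
  rw [List.take_reverse, show U.length - (v - 1) = e by omega] at hY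
  have := (append_sublist_iff_greedyRest P (U.drop s) Y.reverse).2
    ⟨_, hR, by simpa using hY.reverse⟩
  simpa using hX.append this

/-- The cut is placed behind the part of `U` that hosts `X`; after it, the greedy embedding of `P`
leaves enough room for `Y`. -/
theorem exists_split {α : Type*} {P U X Y : List α} {e : ℕ → ℕ}
    (he : ∀ s, s ≤ U.length → IsEnd P U s (e s)) (h : List.Sublist (X ++ (P ++ Y)) U) :
    ∃ s, s ≤ U.length ∧ e s ≠ 0 ∧ e s - 1 ≤ U.length ∧ List.Sublist X (U.take s) ∧
      List.Sublist Y.reverse (U.reverse.take (e s - 1)) := by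
  obtain ⟨U₁, U₂, rfl, h1, h2⟩ := List.append_sublist_iff.1 h
  have hs : U₁.length ≤ (U₁ ++ U₂).length := by simp
  refine ⟨U₁.length, hs, ?_⟩
  have hd : (U₁ ++ U₂).drop U₁.length = U₂ := by simp
  obtain ⟨R, hR, hY⟩ := (append_sublist_iff_greedyRest _ _ _).1 h2
  rcases he _ hs with h | ⟨d, hd1, hd2, hd3⟩
  · rw [hd, hR] at h; simp at h
  · rw [hd, hR] at hd3
    refine ⟨by omega, by omega, by simpa using h1, ?_⟩
    rw [List.take_reverse, show (U₁ ++ U₂).length - (e U₁.length - 1) = d by omega,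
      List.reverse_sublist]
    rwa [Option.some.inj hd3] at hY

/-- The upper bound for the optimum. The last conjunct shows that a search which finds only the
value `0` proves that no solution exists. -/
theorem IsFeasible.exists_splitValue {α : Type*} {n : ℕ} {A B P Z : List α} {eA eB : ℕ → ℕ}
    (hA : A.length = n) (hB : B.length = n) (heA : ∀ s, s ≤ n → IsEnd P A s (eA s))
    (heB : ∀ s, s ≤ n → IsEnd P B s (eB s)) (hZ : IsFeasible A B P Z) :
    ∃ i j, i ≤ n ∧ j ≤ n ∧
      Z.length + 1 ≤ splitValue (prefixLcs A B) (prefixLcs A.reverse B.reverse) eA eB i j +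
        P.length ∧
      splitValue (prefixLcs A B) (prefixLcs A.reverse B.reverse) eA eB i j ≠ 0 := by
  obtain ⟨⟨X, Y, rfl⟩, h1, h2⟩ := hZ
  rw [List.append_assoc] at h1 h2
  obtain ⟨i, hi, a1, a2, a3, a4⟩ := exists_split (e := eA) (by rwa [hA]) h1
  obtain ⟨j, hj, b1, b2, b3, b4⟩ := exists_split (e := eB) (by rwa [hB]) h2
  refine ⟨i, j, by omega, by omega, ?_⟩
  have l1 := length_le_prefixLcs A B hi hj a3 b3
  have l2 := length_le_prefixLcs A.reverse B.reverse (by simpa using a2) (by simpa using b2) a4 b4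
  rw [splitValue, if_neg (by omega)]
  simp only [List.length_append, List.length_reverse] at l2 ⊢
  omega

/-- The converse direction: common subsequences around a pair of cuts can be glued to the pattern.
-/
theorem isFeasible_of_isEnd {α : Type*} {A B P X Y : List α} {i j u v : ℕ}
    (hu : IsEnd P A i u) (hv : IsEnd P B j v) (hu0 : u ≠ 0) (hv0 : v ≠ 0)
    (hXA : List.Sublist X (A.take i)) (hXB : List.Sublist X (B.take j))
    (hYA : List.Sublist Y (A.reverse.take (u - 1))) (hYB : List.Sublist Y (B.reverse.take (v - 1))) :
    IsFeasible A B P (X ++ (P ++ Y.reverse)) :=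
  ⟨⟨X, Y.reverse, by simp⟩, hu.append_sublist hu0 hXA hYA, hv.append_sublist hv0 hXB hYB⟩

open Prog Arith Test

local infixr:60 " ⨾ " => Prog.seq

/-! ### Look-up in a threshold table

The registers `1`, `3`, `4`, `5` hold `n`, `1`, `n + 1` and the number `D` of cells per level, the
registers `6` and `7` hold the addresses of the two halves of the current table, and register `12`
holds `0`. -/

/-- Set register `38` to `1` if the current table has an entry of at least the value in register
`37` at the position in the registers `35` and `36`, and to `0` otherwise. -/
def query : Prog :=
  const 38 0 ⨾ branch (lt 35 37) skip (branch (lt 36 37) skip (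
    arith sub 39 35 37 ⨾ branch (lt 39 5)
      (arith mul 40 37 5 ⨾ arith add 40 40 39 ⨾ arith add 40 6 40 ⨾ load 41 40 ⨾
        arith sub 42 1 36 ⨾ branch (lt 42 41) (const 38 1) skip)
      (arith sub 39 36 37 ⨾ branch (lt 39 5)
        (arith mul 40 37 5 ⨾ arith add 40 40 39 ⨾ arith add 40 7 40 ⨾ load 41 40 ⨾
          arith sub 42 1 35 ⨾ branch (lt 42 41) (const 38 1) skip)
        (const 38 1))))

/-- The registers and the memory above address `lo` hold a complete table for `f`. -/
structure HasTable {α : Type*} (w m lo n l D : ℕ) (f : ℕ → ℕ → ℕ) (σ : State α) : Prop where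
  grid : IsGrid f
  corner : f n n = l
  width : D + l = n + 1
  reg1 : σ.reg 1 = n
  reg3 : σ.reg 3 = 1
  reg4 : σ.reg 4 = n + 1
  reg5 : σ.reg 5 = D
  lo6 : lo ≤ σ.reg 6
  lo7 : lo ≤ σ.reg 7
  hi6 : σ.reg 6 + (l + 2) * D ≤ m
  hi7 : σ.reg 7 + (l + 2) * D ≤ m
  word : m < 2 ^ w
  small : n + 1 < m
  table : IsTable n l D f σ.mem (σ.reg 6) (σ.reg 7)

theorem HasTable.congr {α : Type*} {w m lo n l D : ℕ} {f : ℕ → ℕ → ℕ} {σ τ : State α}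
    (h : HasTable w m lo n l D f σ) (hr : ∀ r, r ≤ 7 → τ.reg r = σ.reg r)
    (hm : ∀ a, lo ≤ a → τ.mem a = σ.mem a) : HasTable w m lo n l D f τ := by
  have h6 := hr 6 (by omega)
  have h7 := hr 7 (by omega)
  have lo6 := h.lo6
  have lo7 := h.lo7
  refine ⟨h.grid, h.corner, h.width, by rw [hr _ (by omega), h.reg1],
    by rw [hr _ (by omega), h.reg3], by rw [hr _ (by omega), h.reg4],
    by rw [hr _ (by omega), h.reg5], by rwa [h6], by rwa [h7], by rw [h6]; exact h.hi6,
    by rw [h7]; exact h.hi7, h.word, h.small, ?_⟩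
  rw [h6, h7]
  exact h.table.congr (fun a _ _ => hm a (by omega)) (fun a _ _ => hm a (by omega))

/-- The branches are the regions of the table: below the level, in the band of stored rows, in the
band of stored columns, and the remainder, where `IsGrid.le_of_add_le` gives a positive answer. The
level `l + 1` is admitted because `fillRow` asks for one more than the previous entry; for it the
remainder is empty. -/
theorem wp_query {α : Type*} {w m lo n l D i j s : ℕ} {x : Inp → List α} {f : ℕ → ℕ → ℕ}
    {σ : State α} {t : ℕ} (h : HasTable w m lo n l D f σ) (hi : σ.reg 35 = i) (hj : σ.reg 36 = j)
    (hs : σ.reg 37 = s) (hin : i ≤ n) (hjn : j ≤ n) (hs1 : 1 ≤ s) (hsl : s ≤ l + 1) :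
    wp w m x query (fun τ t' => t' ≤ t + 14 ∧ τ.mem = σ.mem ∧
      τ.reg 38 = if s ≤ f i j then 1 else 0) σ t := by
  have hf := h.grid
  have hmul : s * D ≤ (l + 2) * D := Nat.mul_le_mul_right D (by omega)
  have hcell : ∀ k, k < D → s * D + k < (l + 2) * D := fun k hk =>
    cell_lt hk (Nat.mul_le_mul_right D (by omega))
  have w0 : w ≠ 0 := by
    rintro rfl
    have := h.small
    have := h.word
    omega
  have hw := h.word
  have hi6 := h.hi6
  have hi7 := h.hi7
  have hD := h.width
  have fi := hf.le_left i j
  have fj := hf.le_right i j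
  unfold query
  simp [hi, hj, hs, h.reg1, h.reg5, w0]
  refine ⟨fun hc => ?_, fun hc => ⟨fun hc' => ?_, fun hc' => ⟨fun hk => ?_, fun hk =>
    ⟨fun hk' => ?_, fun hk' => ?_⟩⟩⟩⟩
  · omega
  · omega
  · have h1 := hcell _ hk
    have h2 := h.table.row s (i - s) j hs1 hsl hk (by omega) hjn
    rw [show s + (i - s) = i by omega] at h2
    refine ⟨by omega, by omega, by omega, by omega, fun h3 => h2.1 (by omega),
      fun h3 => lt_of_not_ge fun h4 => by have := h2.2 h4; omega⟩
  · have h1 := hcell _ hk'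
    have h2 := h.table.col s (j - s) i hs1 hsl hk' (by omega) hin
    rw [show s + (j - s) = j by omega] at h2
    refine ⟨by omega, by omega, by omega, by omega, fun h3 => h2.1 (by omega),
      fun h3 => lt_of_not_ge fun h4 => by have := h2.2 h4; omega⟩
  · exact hf.le_of_add_le (n := n) (by rw [h.corner]; omega) (by rw [h.corner]; omega)
      (by rw [h.corner]; omega)

/-- Write the row of the current table with the number in register `25` to the memory cells from
the address in register `26` on. -/
def fillRow : Prog :=
  const 27 0 ⨾ const 28 0 ⨾ copy 35 25 ⨾ loop (lt 27 4)
    (copy 36 27 ⨾ arith add 37 28 3 ⨾ query ⨾ arith add 28 28 38 ⨾ arith add 29 26 27 ⨾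
      store 29 28 ⨾ arith add 27 27 3)

/-- Neighbouring entries of a row differ by `0` or `1`, so the answer to a single test at the level
`f i (j - 1) + 1` is the increment. -/
theorem wp_fillRow {α : Type*} {w m lo n l D i d : ℕ} {x : Inp → List α} {f : ℕ → ℕ → ℕ}
    {σ : State α} {t : ℕ} (h : HasTable w m lo n l D f σ) (hi : σ.reg 25 = i)
    (hd : σ.reg 26 = d) (hin : i ≤ n) (hlo : d + (n + 1) ≤ lo) :
    wp w m x fillRow (fun τ t' => t' ≤ t + 4 + (n + 1) * 21 ∧
      (∀ j, j ≤ n → τ.mem (d + j) = f i j) ∧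
      (∀ a, a < d ∨ d + (n + 1) ≤ a → τ.mem a = σ.mem a)) σ t := by
  have hf := h.grid
  have hw := h.word
  have hsm := h.small
  have hlo6 := h.lo6
  have hhi6 := h.hi6
  unfold fillRow
  simp only [wp_seq, wp_const, wp_copy]
  refine ⟨by omega, by omega, ?_⟩
  -- At `j = 0` the truncated index is `0`, and `f i 0 = 0` agrees with the initial counter.
  refine wp_for 20 0 (n + 1) (fun j ρ => ρ.reg 28 = f i (j - 1) ∧
      (∀ k, k < j → ρ.mem (d + k) = f i k) ∧
      (∀ a, a < d ∨ d + (n + 1) ≤ a → ρ.mem a = σ.mem a)) (by simp) (by simp [h.reg4])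
      (by omega) rfl ⟨by simp [hf.zero_right], by simp, by simp⟩ ?_ ?_
  · rintro j ρ s hfr - hj hρj ⟨h28, hrow, hout⟩
    have r3 : ρ.reg 3 = 1 := by simpa [h.reg3] using hfr.1 3 rfl
    have r26 : ρ.reg 26 = d := by simpa [hd] using hfr.1 26 rfl
    have r35 : ρ.reg 35 = i := by simpa [hi] using hfr.1 35 rfl
    have hlast : f i (j - 1) ≤ l := by
      rw [← h.corner]
      exact (hf.le_of_le_right i (by omega)).trans (hf.le_of_le_left n hin)
    have hl : l ≤ n := by rw [← h.corner]; exact hf.le_left n n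
    have hT : HasTable w m lo n l D f ρ := h.congr (fun r hr => by
      rw [hfr.1 r (by interval_cases r <;> rfl)]; simp [show r ≠ 35 by omega,
        show r ≠ 28 by omega, show r ≠ 27 by omega]) (fun a ha => hout a (by omega))
    simp only [wp_seq, wp_copy, wp_add]
    refine ⟨by simp [h28, r3]; omega, ?_⟩
    refine wp_conseq (wp_query (i := i) (j := j) (s := f i (j - 1) + 1)
      (hT.congr (fun r hr => by simp [show r ≠ 37 by omega, show r ≠ 36 by omega])
        (fun _ _ => rfl)) (by simp [r35]) (by simp [hρj]) (by simp [h28, r3]) hin (by omega)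
        (by omega) (by omega)) ?_
    rintro τ t' hfr' ⟨ht, hmem, h38⟩
    have q3 : τ.reg 3 = 1 := by simpa [r3] using hfr'.1 3 rfl
    have q26 : τ.reg 26 = d := by simpa [r26] using hfr'.1 26 rfl
    have q27 : τ.reg 27 = j := by simpa [hρj] using hfr'.1 27 rfl
    have q28 : τ.reg 28 = f i (j - 1) := by simpa [h28] using hfr'.1 28 rfl
    have hnew : f i (j - 1) + τ.reg 38 = f i j := by
      rw [h38]
      cases j with
      | zero => simp [hf.zero_right]
      | succ j =>
        have m1 := hf.mono_right i j
        have m2 := hf.step_right i j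
        simp only [Nat.add_sub_cancel]
        split_ifs <;> omega
    have hjl : f i j ≤ n := hf.le_left i j |>.trans hin
    simp [q3, q26, q27, q28, hnew]
    refine ⟨by omega, by omega, by omega, by omega, by omega, fun k hk => ?_, fun a ha => ?_⟩
    · rcases Nat.lt_or_ge k j with hkj | hkj
      · rw [Function.update_of_ne (by omega), hmem]
        exact hrow k hkj
      · obtain rfl : k = j := by omega
        simp
    · rw [Function.update_of_ne (by omega), hmem]
      exact hout a ha
  · rintro ρ s hfr hρ ⟨-, hrow, hout⟩ hs
    exact ⟨by omega, fun j hj => hrow j (by omega), hout⟩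

/-- Follow the current table from the position in the registers `30` and `31`, where the entry is in
register `32`, back to the border; write the positions of the matches in the first
string, from the last to the first, to the memory cells below the address in register `32`. -/
def traceBack : Prog :=
  loop (lt 12 32)
    (arith sub 35 30 3 ⨾ copy 36 31 ⨾ copy 37 32 ⨾ query ⨾
      branch (lt 12 38) (copy 30 35)
        (copy 35 30 ⨾ arith sub 36 31 3 ⨾ query ⨾
          branch (lt 12 38) (copy 31 36)
            (arith sub 30 30 3 ⨾ copy 31 36 ⨾ arith sub 32 32 3 ⨾ store 32 30)))

/-- If the upper or the left neighbour still reaches the current level, the trace moves there. If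
neither does, the recurrence forces a match, since a mismatch would make the entry their maximum.
Every round lowers the sum of the coordinates. -/
theorem wp_traceBack {α : Type*} {w m lo n l D i₀ j₀ s₀ : ℕ} {x : Inp → List α} {U V : List α}
    {σ : State α} {t : ℕ} (h : HasTable w m lo n l D (prefixLcs U V) σ)
    (hU : U.length = n) (hV : V.length = n) (h12 : σ.reg 12 = 0)
    (hi : σ.reg 30 = i₀) (hj : σ.reg 31 = j₀) (hs : σ.reg 32 = s₀) (hin : i₀ ≤ n) (hjn : j₀ ≤ n)
    (hs₀ : s₀ = prefixLcs U V i₀ j₀) (hlo : n + 1 ≤ lo) :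
    wp w m x traceBack (fun τ t' => t' ≤ t + 1 + (i₀ + j₀) * 50 ∧
      (∀ a, lo ≤ a → τ.mem a = σ.mem a) ∧
      ∃ Z : List α, Z.length = s₀ ∧ List.Sublist Z (U.take i₀) ∧ List.Sublist Z (V.take j₀) ∧
        ∀ k, k < s₀ → τ.mem k < n ∧ U[τ.mem k]? = Z[k]?) σ t := by
  have hf := h.grid
  have hw := h.word
  have hsm := h.small
  unfold traceBack
  -- `Z` is the part found so far: whatever embeds before the current position can be continued by
  -- `Z`. Its positions occupy the cells from the current level up to `s₀`.
  refine wp_while 45 (fun ρ => ρ.reg 30 ≤ i₀ ∧ ρ.reg 31 ≤ j₀ ∧ ρ.reg 32 ≤ s₀ ∧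
      ρ.reg 32 = prefixLcs U V (ρ.reg 30) (ρ.reg 31) ∧
      (∀ a, lo ≤ a → ρ.mem a = σ.mem a) ∧
      ∃ Z : List α, Z.length + ρ.reg 32 = s₀ ∧
        (∀ X, List.Sublist X (U.take (ρ.reg 30)) → List.Sublist (X ++ Z) (U.take i₀)) ∧
        (∀ X, List.Sublist X (V.take (ρ.reg 31)) → List.Sublist (X ++ Z) (V.take j₀)) ∧
        ∀ k, ρ.reg 32 ≤ k → k < s₀ → ρ.mem k < n ∧ U[ρ.mem k]? = Z[k - ρ.reg 32]?)
    (fun ρ => ρ.reg 30 + ρ.reg 31)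
    ⟨by omega, by omega, by omega, by rw [hi, hj, hs, hs₀], fun _ _ => rfl, [], by simp [hs],
      by simp [hi], by simp [hj], fun k h1 h2 => by omega⟩ ?_ ?_
  · rintro ρ t₁ hfr ⟨hi₁, hj₁, hs₁, hfs, hmem, Z, hZ, hZU, hZV, hZm⟩ hpos
    have r3 : ρ.reg 3 = 1 := by simpa [h.reg3] using hfr.1 3 rfl
    have r12 : ρ.reg 12 = 0 := by simpa [h12] using hfr.1 12 rfl
    rw [r12] at hpos
    have hT : HasTable w m lo n l D (prefixLcs U V) ρ := h.congr (fun r hr => by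
      rw [hfr.1 r (by interval_cases r <;> rfl)]) hmem
    obtain ⟨i, hi'⟩ : ∃ i, ρ.reg 30 = i + 1 := by
      refine ⟨ρ.reg 30 - 1, ?_⟩
      rcases Nat.eq_zero_or_pos (ρ.reg 30) with h0 | h0
      · rw [h0, hf.zero_left] at hfs; omega
      · omega
    obtain ⟨j, hj'⟩ : ∃ j, ρ.reg 31 = j + 1 := by
      refine ⟨ρ.reg 31 - 1, ?_⟩
      rcases Nat.eq_zero_or_pos (ρ.reg 31) with h0 | h0
      · rw [h0, hf.zero_right] at hfs; omega
      · omega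
    obtain ⟨s, hs'⟩ : ∃ s, ρ.reg 32 = s + 1 := ⟨ρ.reg 32 - 1, by omega⟩
    have hsl : s + 1 ≤ l := by
      rw [← hs', hfs, ← h.corner]
      exact (hf.le_of_le_right _ (by omega)).trans (hf.le_of_le_left n (by omega))
    rw [hi', hj', hs'] at hfs
    rw [hi'] at hi₁ hZU
    rw [hj'] at hj₁ hZV
    rw [hs'] at hs₁ hpos hZ hZm
    have hln : l ≤ n := by rw [← h.corner]; exact hf.le_left n n
    simp only [wp_seq, wp_copy, wp_sub]
    refine wp_conseq (wp_query (i := i) (j := j + 1) (s := s + 1)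
      (hT.congr (fun r hr => by simp [show r ≠ 37 by omega, show r ≠ 36 by omega,
          show r ≠ 35 by omega])
        (fun _ _ => rfl)) (by simp [r3, hi']) (by simp [hj']) (by simp [hs']) (by omega) (by omega)
        (by omega) (by omega)) ?_
    rintro τ t' hfr' ⟨ht, hm', h38⟩
    have q3 : τ.reg 3 = 1 := by simpa [r3] using hfr'.1 3 rfl
    have q12 : τ.reg 12 = 0 := by simpa [r12] using hfr'.1 12 rfl
    have q30 : τ.reg 30 = i + 1 := by simpa [hi'] using hfr'.1 30 rfl
    have q31 : τ.reg 31 = j + 1 := by simpa [hj'] using hfr'.1 31 rfl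
    have q32 : τ.reg 32 = s + 1 := by simpa [hs'] using hfr'.1 32 rfl
    have q35 : τ.reg 35 = i := by simpa [hi', r3] using hfr'.1 35 rfl
    have q37 : τ.reg 37 = s + 1 := by simpa [hs'] using hfr'.1 37 rfl
    simp only [mem_setReg] at hm'
    rw [wp_branch_lt, q12]
    constructor
    · intro hc
      have hge : s + 1 ≤ prefixLcs U V i (j + 1) := by by_contra h0; simp [h38, h0] at hc
      have hmono := hf.mono_left i (j + 1)
      simp [q31, q32, q35, hm']
      refine ⟨by omega, by omega, by omega, by omega, by omega, by omega, hmem, Z, by omega,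
        fun X hX => hZU X (hX.trans (List.take_sublist_take_left (by omega))), hZV, hZm⟩
    · intro hc
      have hlt : prefixLcs U V i (j + 1) < s + 1 := by
        by_contra h0; simp [h38, Nat.le_of_not_lt h0] at hc
      simp only [wp_seq, wp_copy, wp_sub]
      refine wp_conseq (wp_query (i := i + 1) (j := j) (s := s + 1)
        (hT.congr (fun r hr => by
          have := hfr'.1 r (by interval_cases r <;> rfl)
          simp [show r ≠ 37 by omega, show r ≠ 36 by omega, show r ≠ 35 by omega] at this ⊢
          exact this)
          (fun a _ => by simp [hm'])) (by simp [q30]) (by simp [q31, q3]) (by simp [q37])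
          (by omega) (by omega) (by omega) (by omega)) ?_
      rintro υ t'' hfr'' ⟨ht', hm'', h38'⟩
      have p3 : υ.reg 3 = 1 := by simpa [q3] using hfr''.1 3 rfl
      have p12 : υ.reg 12 = 0 := by simpa [q12] using hfr''.1 12 rfl
      have p30 : υ.reg 30 = i + 1 := by simpa [q30] using hfr''.1 30 rfl
      have p31 : υ.reg 31 = j + 1 := by simpa [q31] using hfr''.1 31 rfl
      have p32 : υ.reg 32 = s + 1 := by simpa [q32] using hfr''.1 32 rfl
      have p36 : υ.reg 36 = j := by simpa [q31, q3] using hfr''.1 36 rfl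
      simp only [mem_setReg] at hm''
      rw [hm'] at hm''
      rw [wp_branch_lt, p12]
      constructor
      · intro hc
        have hge : s + 1 ≤ prefixLcs U V (i + 1) j := by by_contra h0; simp [h38', h0] at hc
        have hmono := hf.mono_right (i + 1) j
        simp [p30, p32, p36, hm'']
        refine ⟨by omega, by omega, by omega, by omega, by omega, by omega, hmem, Z, by omega,
          hZU, fun X hX => hZV X (hX.trans (List.take_sublist_take_left (by omega))), hZm⟩
      · intro hc
        have hlt' : prefixLcs U V (i + 1) j < s + 1 := by
          by_contra h0; simp [h38', Nat.le_of_not_lt h0] at hc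
        have heq : U[i]? = V[j]? := by
          by_contra h0
          rw [prefixLcs_of_ne h0] at hfs
          omega
        rw [prefixLcs_of_eq heq] at hfs
        have hiU : i < U.length := by omega
        have hjV : j < V.length := by omega
        simp [p3, p30, p32, p36, hm'']
        refine ⟨by omega, by omega, by omega, by omega, by omega, by omega, by omega,
          fun a ha => ?_, U[i] :: Z, by simp; omega, fun X hX => ?_, fun X hX => ?_,
          fun k hk hk' => ?_⟩
        · rw [Function.update_of_ne (by omega)]
          exact hmem a ha
        · have := hZU (X ++ [U[i]]) (by
            rw [List.take_add_one, List.getElem?_eq_getElem hiU]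
            exact hX.append (List.Sublist.refl _))
          simpa using this
        · have := hZV (X ++ [U[i]]) (by
            rw [List.take_add_one, ← heq, List.getElem?_eq_getElem hiU]
            exact hX.append (List.Sublist.refl _))
          simpa using this
        · rcases Nat.eq_or_lt_of_le hk with rfl | hk
          · simp [List.getElem?_eq_getElem hiU]; omega
          · rw [Function.update_of_ne (by omega)]
            rw [show k - s = k - (s + 1) + 1 by omega, List.getElem?_cons_succ]
            exact hZm k (by omega) hk'
  · rintro ρ t₁ hfr ⟨hi₁, hj₁, hs₁, hfs, hmem, Z, hZ, hZU, hZV, hZm⟩ hneg ht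
    have r12 : ρ.reg 12 = 0 := by simpa [h12] using hfr.1 12 rfl
    have r32 : ρ.reg 32 = 0 := by omega
    rw [r32] at hZ hZm
    rw [hi, hj] at ht
    exact ⟨by omega, hmem, Z, hZ, by simpa using hZU [] (by simp), by simpa using hZV [] (by simp),
      fun k hk => hZm k (by omega) hk⟩

/-! ### Filling a threshold table -/

/-- The string, reversed on demand. -/
def orient {α : Type*} (rev : Bool) (A : List α) : List α := if rev then A.reverse else A

theorem getElem?_orient {α : Type*} {rev : Bool} {A : List α} {n i : ℕ} (hA : A.length = n)
    (hi : i < n) : A[if rev = true then n - i - 1 else i]? = (orient rev A)[i]? := by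
  cases rev
  · simp [orient]
  · simp only [orient, if_true]
    rw [List.getElem?_reverse (by omega), hA]
    congr 1
    omega

/-- Put the position in register `a`, counted from the end on demand, into register `d`. -/
def mirror (rev : Bool) (d a : ℕ) : Prog :=
  if rev then arith sub d 1 a ⨾ arith sub d d 3 else copy d a

theorem wp_mirror {α : Type*} {w m n d a : ℕ} {x : Inp → List α} {Q : State α → ℕ → Prop}
    {σ : State α} {t : ℕ} {rev : Bool} (h1 : σ.reg 1 = n) (h3 : σ.reg 3 = 1) (hd : d ≠ 3)
    (hQ : ∀ t', t' ≤ t + 2 →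
      Q (σ.setReg d (if rev = true then n - σ.reg a - 1 else σ.reg a)) t') :
    wp w m x (mirror rev d a) Q σ t := by
  cases rev
  · simpa [mirror] using hQ (t + 1) (by omega)
  · have := hQ (t + 2) le_rfl
    have he : (σ.setReg d (n - σ.reg a)).setReg d (n - σ.reg a - 1) =
        σ.setReg d (n - σ.reg a - 1) := by simp [State.setReg]
    simp only [if_true] at this
    rw [← he] at this
    simpa [mirror, h1, h3, Ne.symm hd] using this

/-- Put the next entry of the table of the lengths of longest common subsequences into register `34`. -/
def nextEntry (rev : Bool) : Prog :=
  mirror rev 31 25 ⨾ mirror rev 32 28 ⨾ branch (sym Inp.A 31 Inp.B 32) (arith add 34 27 3)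
    (branch (lt 30 26) (copy 34 26) (copy 34 30))

theorem wp_nextEntry {α : Type*} {w m n i j : ℕ} {A B P : List α} {rev : Bool} {σ : State α}
    {t : ℕ} (hA : A.length = n) (hB : B.length = n) (hw : n + 1 < 2 ^ w) (h1 : σ.reg 1 = n)
    (h3 : σ.reg 3 = 1) (h25 : σ.reg 25 = i) (h28 : σ.reg 28 = j) (hi : i < n) (hj : j < n)
    (h26 : σ.reg 26 = prefixLcs (orient rev A) (orient rev B) (i + 1) j)
    (h27 : σ.reg 27 = prefixLcs (orient rev A) (orient rev B) i j)
    (h30 : σ.reg 30 = prefixLcs (orient rev A) (orient rev B) i (j + 1)) :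
    wp w m (input A B P) (nextEntry rev) (fun τ t' => t' ≤ t + 7 ∧ τ.mem = σ.mem ∧
      τ.reg 34 = prefixLcs (orient rev A) (orient rev B) (i + 1) (j + 1)) σ t := by
  unfold nextEntry
  rw [wp_seq]
  refine wp_mirror h1 h3 (by omega) fun t₁ ht₁ => ?_
  rw [wp_seq]
  refine wp_mirror (n := n) (by simp [h1]) (by simp [h3]) (by omega) fun t₂ ht₂ => ?_
  have hl := (isGrid_prefixLcs (orient rev A) (orient rev B)).le_left i j
  have key : A[if rev = true then n - i - 1 else i]? = B[if rev = true then n - j - 1 else j]? ↔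
      (orient rev A)[i]? = (orient rev B)[j]? := by
    rw [getElem?_orient hA hi, getElem?_orient hB hj]
  have bi : (if rev = true then n - i - 1 else i) < n := by split_ifs <;> omega
  have bj : (if rev = true then n - j - 1 else j) < n := by split_ifs <;> omega
  rw [wp_branch_sym]
  simp only [reg_setReg, if_true, h25, h28, show (31 : ℕ) ≠ 32 by omega,
    show (28 : ℕ) ≠ 31 by omega, if_false]
  refine ⟨by simpa [input, hA] using bi, by simpa [input, hB] using bj, fun hc => ?_,
    fun hc => ?_⟩
  · have he : (orient rev A)[i]? = (orient rev B)[j]? := key.1 hc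
    simp [h27, h3, prefixLcs_of_eq he]
    omega
  · have he : ¬ (orient rev A)[i]? = (orient rev B)[j]? := fun h => hc (key.2 h)
    simp [h26, h30, prefixLcs_of_ne he]
    omega

/-- Record in the half table at the address in register `b` that the entry in register `34`, in the
row in register `y`, is larger than the previous one in register `old`. The column is in register
`c`. -/
def storeMark (old y b c : ℕ) : Prog :=
  branch (lt old 34)
    (arith sub 40 y 34 ⨾ branch (lt 40 5)
      (arith mul 41 34 5 ⨾ arith add 41 41 40 ⨾ arith add 41 b 41 ⨾ arith sub 42 1 c ⨾
        store 41 42) skip) skip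

/-- The address has to be valid only if a mark is written. For `D = 0` this never happens, which
allows a pass without any table. -/
theorem wp_storeMark {α : Type*} {w m old y b c D new : ℕ} {x : Inp → List α} {σ : State α}
    {t : ℕ} (hb : b < 40) (hc : c < 40) (hD : σ.reg 5 = D)
    (hnew : σ.reg 34 = new) (hw : m < 2 ^ w)
    (hm : σ.reg old < new → σ.reg y - new < D → σ.reg b + (new * D + (σ.reg y - new)) < m) :
    wp w m x (storeMark old y b c) (fun τ t' => t' ≤ t + 8 ∧
      τ.mem = if σ.reg old < new ∧ σ.reg y - new < D then
        Function.update σ.mem (σ.reg b + (new * D + (σ.reg y - new))) (σ.reg 1 - σ.reg c)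
        else σ.mem) σ t := by
  unfold storeMark
  simp only [wp_branch_lt, wp_seq, wp_sub, wp_mul, wp_add, wp_store, wp_skip]
  refine ⟨fun h1 => ⟨fun h2 => ?_, fun h2 => ?_⟩, fun h1 => ?_⟩
  · have hb40 : b ≠ 40 := by omega
    have hb41 : b ≠ 41 := by omega
    have hc40 : c ≠ 40 := by omega
    have hc41 : c ≠ 41 := by omega
    simp [hD, hnew] at h1 h2
    have := hm h1 h2
    simp [hD, hnew, hb40, hb41, hc40, hc41, h1, h2]
    omega
  · simp [hD, hnew] at h1 h2
    simp [Nat.not_lt.2 h2]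
  · rw [hnew] at h1
    simp [h1]

/-- Compute one entry of the table of the lengths of longest common subsequences, in the row with
the number in register `33`, and record the marks. -/
def cellStep (rev : Bool) : Prog :=
  arith add 29 28 3 ⨾ load 30 29 ⨾ nextEntry rev ⨾ store 29 34 ⨾ storeMark 26 33 6 28 ⨾
    storeMark 30 29 7 25 ⨾ copy 27 30 ⨾ copy 26 34 ⨾ copy 28 29

/-- The state of the computation of a threshold table: the rows up to `i` are complete, and the row
`i + 1` is complete up to column `j`. -/
structure Filling {α : Type*} (n D S b b' : ℕ) (mem₀ : ℕ → ℕ) (f : ℕ → ℕ → ℕ) (i j : ℕ)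
    (σ : State α) : Prop where
  row : ∀ k, k ≤ n → σ.mem k = if k ≤ j then f (i + 1) k else f i k
  marks : Marked n D S f (fun y => if y ≤ i then n else if y = i + 1 then j else 0) σ.mem b
  -- Entries are produced row by row, so the columns up to `j` are one row ahead of the later ones;
  -- columns beyond `n` are never scanned.
  marks' : Marked n D S (fun i j => f j i)
    (fun y => if y ≤ j then i + 1 else if y ≤ n then i else 0) σ.mem b'
  other : ∀ a, n < a → (a < b ∨ b + S ≤ a) → (a < b' ∨ b' + S ≤ a) → σ.mem a = mem₀ a

/-- The row is updated in place, so the diagonal neighbour has to survive in register `27`;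
registers `26` and `30` hold the left and the upper neighbour. The new entry continues both its row
and its column, whence one mark for each half. -/
theorem wp_cellStep {α : Type*} {w m n i j D S b b' : ℕ} {A B P : List α} {rev : Bool}
    {mem₀ : ℕ → ℕ} {f : ℕ → ℕ → ℕ} {σ : State α} {t : ℕ} (hA : A.length = n) (hB : B.length = n)
    (hf : f = prefixLcs (orient rev A) (orient rev B))
    (hw : m < 2 ^ w) (hnm : n + 1 < m) (h1 : σ.reg 1 = n) (h3 : σ.reg 3 = 1) (h5 : σ.reg 5 = D)
    (h6 : σ.reg 6 = b) (h7 : σ.reg 7 = b')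
    (hb : n < b) (hb' : b + S ≤ b') (hm : b' + S ≤ m) (hS : (f n n + 1) * D ≤ S)
    (h25 : σ.reg 25 = i) (h28 : σ.reg 28 = j) (hi : i < n) (hj : j < n) (h33 : σ.reg 33 = i + 1)
    (h26 : σ.reg 26 = f (i + 1) j) (h27 : σ.reg 27 = f i j)
    (hfill : Filling n D S b b' mem₀ f i j σ) :
    wp w m (input A B P) (cellStep rev) (fun τ t' => t' ≤ t + 30 ∧ τ.reg 28 = j + 1 ∧
      τ.reg 26 = f (i + 1) (j + 1) ∧ τ.reg 27 = f i (j + 1) ∧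
      Filling n D S b b' mem₀ f i (j + 1) τ) σ t := by
  have hg : IsGrid f := hf ▸ isGrid_prefixLcs _ _
  have hle : f (i + 1) (j + 1) ≤ f n n :=
    (hg.le_of_le_left _ (by omega)).trans (hg.le_of_le_right _ (by omega))
  have hcell : ∀ k, k < D → f (i + 1) (j + 1) * D + k < S := fun k hk =>
    cell_lt hk ((Nat.mul_le_mul_right D (by omega)).trans hS)
  have hup : σ.mem (j + 1) = f i (j + 1) := by
    rw [hfill.row _ (by omega), if_neg (by omega)]
  unfold cellStep
  simp only [wp_seq, wp_add, wp_load]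
  refine ⟨by simp [h28, h3]; omega, by simp [h28, h3]; omega, ?_⟩
  refine wp_conseq (wp_nextEntry (n := n) (i := i) (j := j) hA hB (by omega) (by simp [h1])
    (by simp [h3]) (by simp [h25]) (by simp [h28]) hi hj (by simp [h26, hf]) (by simp [h27, hf])
    (by simp [h28, h3, hup, hf])) ?_
  rintro ρ t₁ hfr ⟨ht₁, hmem₁, h34⟩
  have keep : ∀ r, (nextEntry rev).keeps r = true → r ≠ 29 → r ≠ 30 → ρ.reg r = σ.reg r :=
    fun r hr h h' => by rw [hfr.1 r hr]; simp [h, h']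
  have r1 : ρ.reg 1 = n := by rw [keep 1 (by cases rev <;> rfl) (by omega) (by omega), h1]
  have r5 : ρ.reg 5 = D := by rw [keep 5 (by cases rev <;> rfl) (by omega) (by omega), h5]
  have r6 : ρ.reg 6 = b := by rw [keep 6 (by cases rev <;> rfl) (by omega) (by omega), h6]
  have r7 : ρ.reg 7 = b' := by rw [keep 7 (by cases rev <;> rfl) (by omega) (by omega), h7]
  have r25 : ρ.reg 25 = i := by rw [keep 25 (by cases rev <;> rfl) (by omega) (by omega), h25]
  have r26 : ρ.reg 26 = f (i + 1) j := by
    rw [keep 26 (by cases rev <;> rfl) (by omega) (by omega), h26]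
  have r28 : ρ.reg 28 = j := by rw [keep 28 (by cases rev <;> rfl) (by omega) (by omega), h28]
  have r33 : ρ.reg 33 = i + 1 := by
    rw [keep 33 (by cases rev <;> rfl) (by omega) (by omega), h33]
  have r29 : ρ.reg 29 = j + 1 := by
    rw [hfr.1 29 (by cases rev <;> rfl)]; simp [h28, h3]
  have r30 : ρ.reg 30 = f i (j + 1) := by
    rw [hfr.1 30 (by cases rev <;> rfl)]; simp [h28, h3, hup]
  rw [← hf] at h34
  simp only [mem_setReg] at hmem₁
  simp only [wp_seq, wp_store, r29, h34]
  refine ⟨by omega, ?_⟩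
  refine wp_conseq (wp_storeMark (D := D) (new := f (i + 1) (j + 1)) (by omega) (by omega)
    (by simp [r5]) (by simp [h34]) hw ?_) ?_
  · simp only [reg_setMem, r6, r33]
    intro _ hk
    have := hcell _ hk
    omega
  rintro τ t₂ hfr₂ ⟨ht₂, hmem₂⟩
  have q1 : τ.reg 1 = n := by rw [hfr₂.1 1 rfl]; exact r1
  have q5 : τ.reg 5 = D := by rw [hfr₂.1 5 rfl]; exact r5
  have q7 : τ.reg 7 = b' := by rw [hfr₂.1 7 rfl]; exact r7
  have q25 : τ.reg 25 = i := by rw [hfr₂.1 25 rfl]; exact r25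
  have q29 : τ.reg 29 = j + 1 := by rw [hfr₂.1 29 rfl]; exact r29
  have q30 : τ.reg 30 = f i (j + 1) := by rw [hfr₂.1 30 rfl]; exact r30
  have q34 : τ.reg 34 = f (i + 1) (j + 1) := by rw [hfr₂.1 34 rfl]; exact h34
  simp only [reg_setMem, mem_setMem, r1, r6, r33, r26, r28, hmem₁] at hmem₂
  rw [wp_seq]
  refine wp_conseq (wp_storeMark (D := D) (new := f (i + 1) (j + 1)) (by omega) (by omega)
    q5 q34 hw ?_) ?_
  · simp only [q7, q29]
    intro _ hk
    have := hcell _ hk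
    omega
  rintro υ t₃ hfr₃ ⟨ht₃, hmem₃⟩
  have p29 : υ.reg 29 = j + 1 := by rw [hfr₃.1 29 rfl]; exact q29
  have p30 : υ.reg 30 = f i (j + 1) := by rw [hfr₃.1 30 rfl]; exact q30
  have p34 : υ.reg 34 = f (i + 1) (j + 1) := by rw [hfr₃.1 34 rfl]; exact q34
  simp only [q1, q7, q25, q29, q30] at hmem₃
  simp [p29, p30, p34]
  have e2 : ∀ a, (a < b ∨ b + S ≤ a) → τ.mem a = Function.update σ.mem (j + 1)
      (f (i + 1) (j + 1)) a := by
    intro a ha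
    rw [hmem₂]
    split_ifs with hc
    · have := hcell _ hc.2
      rw [Function.update_of_ne (by omega)]
    · rfl
  have e3 : ∀ a, (a < b' ∨ b' + S ≤ a) → υ.mem a = τ.mem a := by
    intro a ha
    rw [hmem₃]
    split_ifs with hc
    · have := hcell _ hc.2
      rw [Function.update_of_ne (by omega)]
    · rfl
  refine ⟨by omega, fun k hk => ?_, ?_, ?_, fun a ha hab hab' => ?_⟩
  · simp only [mem_setReg]
    rw [e3 k (by omega), e2 k (by omega)]
    rcases eq_or_ne k (j + 1) with rfl | hne
    · simp
    · rw [Function.update_of_ne hne, hfill.row k hk]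
      by_cases hkj : k ≤ j
      · rw [if_pos hkj, if_pos (by omega)]
      · rw [if_neg hkj, if_neg (by omega)]
  · have m1 : Marked n D S f (fun y => if y ≤ i then n else if y = i + 1 then j else 0)
        (Function.update σ.mem (j + 1) (f (i + 1) (j + 1))) b :=
      hfill.marks.congr (fun _ _ => rfl) (fun a ha _ => Function.update_of_ne (by omega) _ _)
    have m2 := m1.step (y := i + 1) (j := j)
      (J' := fun y => if y ≤ i then n else if y = i + 1 then j + 1 else 0) hg
      (by simp) (by simp) (fun z hz => by simp [hz])
    rw [← hmem₂] at m2
    exact m2.congr (fun _ _ => rfl) (fun a ha ha' => by simp [e3 a (by omega)])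
  · have m1 : Marked n D S (fun i j => f j i)
        (fun y => if y ≤ j then i + 1 else if y ≤ n then i else 0) τ.mem b' :=
      hfill.marks'.congr (fun _ _ => rfl) (fun a ha _ => by
        rw [e2 a (by omega), Function.update_of_ne (by omega)])
    have m2 := m1.step (y := j + 1) (j := i)
      (J' := fun y => if y ≤ j + 1 then i + 1 else if y ≤ n then i else 0) hg.swap
      (by simp; omega) (by simp) (fun z hz => by
        by_cases hzj : z ≤ j
        · simp [hzj, show z ≤ j + 1 by omega]
        · simp [hzj, show ¬ z ≤ j + 1 by omega])
    rw [← hmem₃] at m2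
    exact m2
  · simp only [mem_setReg]
    rw [e3 a hab', e2 a hab, Function.update_of_ne (by omega)]
    exact hfill.other a ha hab hab'

/-- Compute the lengths of the longest common subsequences of prefixes (or of suffixes), and fill
the threshold table at the addresses in the registers `6` and `7`. The memory cells up to address
`n` are used for the rows; in the end they hold the last row. -/
def fillTable (rev : Bool) : Prog :=
  const 25 0 ⨾ loop (lt 25 4) (store 25 12 ⨾ arith add 25 25 3) ⨾ const 25 0 ⨾ loop (lt 25 1)
    (const 26 0 ⨾ const 27 0 ⨾ const 28 0 ⨾ arith add 33 25 3 ⨾ loop (lt 28 1) (cellStep rev) ⨾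
      copy 25 33)

theorem wp_fillTable {α : Type*} {w m n D S b b' : ℕ} {A B P : List α} {rev : Bool}
    {f : ℕ → ℕ → ℕ} {σ : State α} {t : ℕ} (hA : A.length = n) (hB : B.length = n)
    (hf : f = prefixLcs (orient rev A) (orient rev B))
    (hw : m < 2 ^ w) (hnm : n + 1 < m) (h1 : σ.reg 1 = n) (h3 : σ.reg 3 = 1)
    (h4 : σ.reg 4 = n + 1) (h5 : σ.reg 5 = D) (h6 : σ.reg 6 = b) (h7 : σ.reg 7 = b')
    (h12 : σ.reg 12 = 0) (hb : n < b) (hb' : b + S ≤ b') (hm : b' + S ≤ m)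
    (hS : (f n n + 1) * D ≤ S) (hz : ∀ a, b ≤ a → a < b + S → σ.mem a = 0)
    (hz' : ∀ a, b' ≤ a → a < b' + S → σ.mem a = 0) :
    wp w m (input A B P) (fillTable rev) (fun τ t' => t' ≤ t + 20 + n * 20 + n * (n * 31) ∧
      τ.mem n = f n n ∧
      (∀ a, n < a → (a < b ∨ b + S ≤ a) → (a < b' ∨ b' + S ≤ a) → τ.mem a = σ.mem a) ∧
      ∃ J J' : ℕ → ℕ, (∀ y, 1 ≤ y → y ≤ n → J y = n) ∧ (∀ y, 1 ≤ y → y ≤ n → J' y = n) ∧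
        Marked n D S f J τ.mem b ∧ Marked n D S (fun i j => f j i) J' τ.mem b') σ t := by
  have hg : IsGrid f := hf ▸ isGrid_prefixLcs _ _
  unfold fillTable
  simp only [wp_seq, wp_const]
  refine ⟨by omega, ?_⟩
  -- The cells of the row are cleared explicitly, since an earlier pass leaves its last row there.
  refine wp_for 2 0 (n + 1) (fun i ρ => (∀ a, a < i → ρ.mem a = 0) ∧
    ∀ a, n < a → ρ.mem a = σ.mem a) (by simp) (by simp [h4]) (by omega) rfl
    ⟨by simp, by simp⟩ ?_ ?_
  · rintro i ρ s hfr - hi hρi ⟨hzero, hsame⟩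
    have r3 : ρ.reg 3 = 1 := by simpa [h3] using hfr.1 3 rfl
    have r12 : ρ.reg 12 = 0 := by simpa [h12] using hfr.1 12 rfl
    simp [hρi, r3, r12]
    refine ⟨by omega, by omega, fun a ha => ?_, fun a ha => ?_⟩
    · rcases eq_or_ne a i with rfl | hne
      · simp
      · rw [Function.update_of_ne hne, hzero a (by omega)]
    · rw [Function.update_of_ne (by omega), hsame a ha]
  rintro ρ s hfr - ⟨hzero, hsame⟩ hs
  have keep : ∀ r, r ≤ 24 → ρ.reg r = σ.reg r := fun r hr => by
    rw [hfr.1 r (by interval_cases r <;> rfl)]; simp [show r ≠ 25 by omega]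
  refine ⟨by omega, ?_⟩
  refine wp_for (7 + n * 31) 0 n (fun i τ => Filling n D S b b' σ.mem f i 0 τ) (by simp)
    (by simp [keep 1, h1]) (by omega) (by cases rev <;> rfl) ?_ ?_ ?_
  · refine ⟨fun k hk => ?_, ?_, ?_, fun a ha _ _ => hsame a ha⟩
    · simp only [mem_setReg, hzero k (by omega), hg.zero_left]
      split_ifs with hk0
      · rw [show k = 0 by omega, hg.zero_right]
      · rfl
    · exact (Marked.zero (f := f) (mem := ρ.mem) (fun a ha ha' => by
        rw [hsame a (by omega), hz a ha ha'])).congr (fun y hy => by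
          simp [show y ≠ 0 by omega]) (fun _ _ _ => rfl)
    · exact (Marked.zero (mem := ρ.mem) (fun a ha ha' => by
        rw [hsame a (by omega), hz' a ha ha'])).congr (fun y hy => by
          simp [show y ≠ 0 by omega]) (fun _ _ _ => rfl)
  · rintro i τ s' hfr' - hi hτi hfill
    have keep' : ∀ r, r ≤ 24 → τ.reg r = σ.reg r := fun r hr => by
      rw [hfr'.1 r (by cases rev <;> interval_cases r <;> rfl)]
      simp [show r ≠ 25 by omega, keep r hr]
    simp only [wp_seq, wp_const, wp_add]
    refine ⟨by omega, by omega, by omega, by simp [hτi, keep' 3, h3]; omega, ?_⟩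
    refine wp_for 30 0 n (fun j υ => υ.reg 26 = f (i + 1) j ∧ υ.reg 27 = f i j ∧
      Filling n D S b b' σ.mem f i j υ) (by simp) (by simp [keep' 1, h1]) (by omega)
      (by cases rev <;> rfl) ?_ ?_ ?_
    · exact ⟨by simp [hg.zero_right], by simp [hg.zero_right], hfill.row, hfill.marks,
        hfill.marks', hfill.other⟩
    · rintro j υ s₂ hfr₂ - hj hυj ⟨h26, h27, hfill₂⟩
      have keep₂ : ∀ r, r ≤ 24 → υ.reg r = σ.reg r := fun r hr => by
        rw [hfr₂.1 r (by cases rev <;> interval_cases r <;> rfl)]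
        simp [show r ≠ 26 by omega, show r ≠ 27 by omega, show r ≠ 28 by omega,
          show r ≠ 33 by omega, keep' r hr]
      have r25 : υ.reg 25 = i := by rw [hfr₂.1 25 (by cases rev <;> rfl)]; simp [hτi]
      have r33 : υ.reg 33 = i + 1 := by
        rw [hfr₂.1 33 (by cases rev <;> rfl)]; simp [hτi, keep' 3, h3]
      exact wp_mono (wp_cellStep hA hB hf hw hnm (by rw [keep₂ 1 (by omega), h1])
        (by rw [keep₂ 3 (by omega), h3]) (by rw [keep₂ 5 (by omega), h5])
        (by rw [keep₂ 6 (by omega), h6]) (by rw [keep₂ 7 (by omega), h7]) hb hb' hm hS r25 hυj hi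
        hj r33 h26 h27 hfill₂) fun _ _ h => h
    · rintro υ s₂ hfr₂ - ⟨-, -, hfill₂⟩ hs₂
      have r33 : υ.reg 33 = i + 1 := by
        rw [hfr₂.1 33 (by cases rev <;> rfl)]; simp [hτi, keep' 3, h3]
      simp [r33]
      refine ⟨by omega, fun k hk => ?_, ?_, ?_, hfill₂.other⟩
      · simp only [mem_setReg]
        rw [hfill₂.row k hk, if_pos hk]
        split_ifs with hk0
        · rw [show k = 0 by omega, hg.zero_right, hg.zero_right]
        · rfl
      · refine hfill₂.marks.congr (fun y hy => ?_) (fun _ _ _ => rfl)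
        by_cases h : y ≤ i
        · simp [h, show y ≤ i + 1 by omega]
        · by_cases h' : y = i + 1
          · simp [h']
          · simp [h, h', show ¬ y ≤ i + 1 by omega]
      · refine hfill₂.marks'.congr (fun y hy => ?_) (fun _ _ _ => rfl)
        by_cases h : y ≤ n
        · simp [h, show y ≠ 0 by omega]
        · simp [h, show y ≠ 0 by omega]
  · rintro τ s' hfr' - hfill hs'
    have ht : n * (7 + n * 31 + 1) = n * 8 + n * (n * 31) := by ring
    refine ⟨by simp only [Nat.sub_zero] at hs hs'; omega, ?_, hfill.other, _, _, ?_, ?_,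
      hfill.marks, hfill.marks'⟩
    · rw [hfill.row n le_rfl]
      split_ifs with h0
      · rw [show n = 0 by omega, hg.zero_right, hg.zero_right]
      · rfl
    · intro y _ hy; simp [hy]
    · intro y hy hy'; simp [hy', show y ≠ 0 by omega]

/-! ### The leftmost embeddings of the pattern -/

/-- For every starting position in the string `u`, find the leftmost embedding of the pattern by a
greedy scan, and write where it ends to the memory cells from the address in register `d` on. -/
def scan (u : Inp) (d : ℕ) : Prog :=
  const 25 0 ⨾ loop (lt 25 4)
    (copy 26 25 ⨾ copy 27 25 ⨾ const 28 0 ⨾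
      loop (lt 26 1) (branch (lt 28 2)
        (arith add 27 26 3 ⨾ branch (sym u 26 Inp.P 28) (arith add 28 28 3) skip) skip ⨾
          arith add 26 26 3) ⨾
      arith add 29 d 25 ⨾ branch (lt 28 2) (store 29 12) (arith sub 30 4 27 ⨾ store 29 30) ⨾
      arith add 25 25 3)

/-- The inner invariant equates the greedy rest of the full problem with that of the remaining
pattern in the remaining string. Register `27` follows the scan only while the pattern is
incomplete, so finally it holds the end of the embedding. -/
theorem wp_scan {α : Type*} {w m n r d : ℕ} {x : Inp → List α} {u : Inp} {U P : List α}
    {σ : State α} {t : ℕ} (hxU : x u = U) (hxP : x Inp.P = P) (hU : U.length = n)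
    (hP : P.length = r) (hw : m < 2 ^ w) (hrn : r ≤ n) (h1 : σ.reg 1 = n) (h2 : σ.reg 2 = r)
    (h3 : σ.reg 3 = 1) (h4 : σ.reg 4 = n + 1) (h12 : σ.reg 12 = 0) (hd : d < 25)
    (hm : σ.reg d + (n + 1) < m) :
    wp w m x (scan u d) (fun τ t' => t' ≤ t + 2 + (n + 1) * (n * 7 + 12) ∧
      (∀ s, s ≤ n → IsEnd P U s (τ.mem (σ.reg d + s))) ∧
      ∀ a, (a < σ.reg d ∨ σ.reg d + (n + 1) ≤ a) → τ.mem a = σ.mem a) σ t := by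
  unfold scan
  simp only [wp_seq, wp_const]
  refine ⟨by omega, ?_⟩
  refine wp_for (n * 7 + 11) 0 (n + 1) (fun s ρ =>
      (∀ s', s' < s → IsEnd P U s' (ρ.mem (σ.reg d + s'))) ∧
      ∀ a, (a < σ.reg d ∨ σ.reg d + (n + 1) ≤ a) → ρ.mem a = σ.mem a) (by simp)
      (by simp [h4]) (by omega) rfl ⟨by simp, by simp⟩ ?_ ?_
  · rintro s ρ t₁ hfr - hs hρs ⟨hend, hsame⟩
    have r_lt : ∀ r, r < 25 → ρ.reg r = σ.reg r := fun r hr => by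
      rw [hfr.1 r (by simp [Prog.keeps, bne_iff_ne]; omega)]; simp [show r ≠ 25 by omega]
    simp only [wp_seq, wp_copy, wp_const]
    refine ⟨by omega, ?_⟩
    refine wp_for 6 s n (fun p τ => τ.mem = ρ.mem ∧ τ.reg 28 ≤ r ∧ τ.reg 27 ≤ p ∧
      (τ.reg 28 < r → τ.reg 27 = p) ∧ greedyRest P (U.drop s) =
        greedyRest (P.drop (τ.reg 28)) (U.drop (τ.reg 27))) (by simp [hρs])
        (by simp [r_lt 1, h1]) (by omega) rfl (by simp [hρs]) ?_ ?_
    · rintro p τ t₂ hfr₂ hsp hpn hτp ⟨hmem, hk, he, hke, hgr⟩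
      have q_lt : ∀ r, r < 25 → τ.reg r = σ.reg r := fun r hr => by
        rw [hfr₂.1 r (by simp [Prog.keeps, bne_iff_ne]; omega)]
        simp [show r ≠ 26 by omega, show r ≠ 27 by omega, show r ≠ 28 by omega, r_lt r hr]
      have q2 := q_lt 2 (by omega)
      have q3 := q_lt 3 (by omega)
      simp only [wp_seq, wp_branch_lt, q2, h2]
      refine ⟨fun hkr => ?_, fun hkr => ?_⟩
      · have hkP : τ.reg 28 < P.length := by omega
        have hpU : p < U.length := by omega
        rw [hke hkr, List.drop_eq_getElem_cons hkP, List.drop_eq_getElem_cons hpU,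
          greedyRest] at hgr
        simp [q3, h3, hτp, hxU, hxP, hU, hP, hpn, hkr]
        refine ⟨by omega, fun hc => ?_, fun hc => ?_⟩
        · rw [if_pos hc] at hgr
          exact ⟨by omega, by omega, hmem, hgr⟩
        · rw [if_neg hc, ← List.drop_eq_getElem_cons hkP] at hgr
          exact ⟨by omega, hmem, hk, hgr⟩
      · simp [q3, h3, hτp]
        exact ⟨by omega, hmem, hk, by omega, fun h => absurd h hkr, hgr⟩
    · rintro τ t₂ hfr₂ - ⟨hmem, hk, he, hke, hgr⟩ ht₂
      have q_lt : ∀ r, r < 25 → τ.reg r = σ.reg r := fun r hr => by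
        rw [hfr₂.1 r (by simp [Prog.keeps, bne_iff_ne]; omega)]
        simp [show r ≠ 26 by omega, show r ≠ 27 by omega, show r ≠ 28 by omega, r_lt r hr]
      have q25 : τ.reg 25 = s := by rw [hfr₂.1 25 rfl]; simp [hρs]
      have ht : (n - s) * 7 ≤ n * 7 := Nat.mul_le_mul_right 7 (by omega)
      have key : ∀ v, IsEnd P U s v → (∀ s', s' ≤ s → IsEnd P U s'
          (Function.update ρ.mem (σ.reg d + s) v (σ.reg d + s'))) ∧
          ∀ a, (a < σ.reg d ∨ σ.reg d + (n + 1) ≤ a) →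
            Function.update ρ.mem (σ.reg d + s) v a = σ.mem a := by
        intro v hv
        refine ⟨fun s' hs' => ?_, fun a ha => ?_⟩
        · rcases eq_or_ne s' s with rfl | hne
          · simpa using hv
          · rw [Function.update_of_ne (by omega)]
            exact hend s' (by omega)
        · rw [Function.update_of_ne (by omega)]
          exact hsame a ha
      have d29 : d ≠ 29 := by omega
      simp [q_lt d hd, q_lt 2, q_lt 3, q_lt 4, q_lt 12, h2, h3, h4, h12, q25, hmem]
      refine ⟨by omega, fun hkr => ⟨by omega, by omega, by omega, key _ (Or.inl ⟨rfl, ?_⟩)⟩,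
        fun hkr => ⟨by omega, by omega, by omega, key _ (Or.inr ⟨τ.reg 27, by omega, by omega, ?_⟩)⟩⟩
      · rw [hgr, hke hkr, ← hU, List.drop_length, List.drop_eq_getElem_cons (by omega), greedyRest]
      · rw [hgr, List.drop_eq_nil_of_le (by omega), greedyRest]
  · rintro ρ t₁ hfr - ⟨hend, hsame⟩ ht₁
    rw [Nat.sub_zero, show n * 7 + 11 + 1 = n * 7 + 12 from rfl] at ht₁
    exact ⟨by omega, fun s hs => hend s (by omega), hsame⟩

/-! ### The search for the best pair of starting positions -/

/-- `HasTable` for the table whose two addresses are in the registers `a` and `b`. -/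
def HasTableAt {α : Type*} (w m lo n l D : ℕ) (f : ℕ → ℕ → ℕ) (a b : ℕ) (σ : State α) : Prop :=
  HasTable w m lo n l D f ((σ.setReg 6 (σ.reg a)).setReg 7 (σ.reg b))

/-- Registers `6` and `7` are exempt because switching between the two tables overwrites them. -/
theorem HasTableAt.congr {α : Type*} {w m lo n l D a b : ℕ} {f : ℕ → ℕ → ℕ} {σ τ : State α}
    (h : HasTableAt w m lo n l D f a b σ) (ha : a ≠ 6) (hb : b ≠ 6) (ha' : a ≠ 7) (hb' : b ≠ 7)
    (ha15 : a ≤ 15) (hb15 : b ≤ 15)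
    (hr : ∀ r, r ≤ 15 → r ≠ 6 → r ≠ 7 → τ.reg r = σ.reg r)
    (hm : ∀ a, lo ≤ a → τ.mem a = σ.mem a) : HasTableAt w m lo n l D f a b τ := by
  refine HasTable.congr h (fun r hr7 => ?_) hm
  simp only [reg_setReg]
  split_ifs
  · exact hr b hb15 hb hb'
  · exact hr a ha15 ha ha'
  · exact hr r (by omega) (by assumption) (by assumption)

/-- Among the pairs of starting positions considered so far, the registers from `18` to `24` describe
one of maximal value, if there is one of positive value. -/
structure IsBest (n : ℕ) (f g : ℕ → ℕ → ℕ) (eA eB : ℕ → ℕ) (done : ℕ → ℕ → Prop)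
    (reg : ℕ → ℕ) : Prop where
  upper : ∀ i j, i ≤ n → j ≤ n → done i j → splitValue f g eA eB i j ≤ reg 18
  attained : reg 18 = 0 ∨ (reg 19 ≤ n ∧ reg 20 ≤ n ∧ eA (reg 19) = reg 21 + 1 ∧
    eB (reg 20) = reg 22 + 1 ∧ reg 23 = f (reg 19) (reg 20) ∧ reg 24 = g (reg 21) (reg 22) ∧
    reg 18 = reg 23 + reg 24 + 1)

theorem IsBest.congr {n : ℕ} {f g : ℕ → ℕ → ℕ} {eA eB : ℕ → ℕ} {done done' : ℕ → ℕ → Prop}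
    {reg reg' : ℕ → ℕ} (h : IsBest n f g eA eB done reg)
    (hd : ∀ i j, i ≤ n → j ≤ n → done' i j → done i j ∨ splitValue f g eA eB i j = 0)
    (hr : ∀ r, 18 ≤ r → r ≤ 24 → reg' r = reg r) : IsBest n f g eA eB done' reg' := by
  refine ⟨fun i j hi hj hij => ?_, ?_⟩
  · rw [hr 18 (by omega) (by omega)]
    rcases hd i j hi hj hij with h' | h'
    · exact h.upper i j hi hj h'
    · omega
  · rw [hr 18 (by omega) (by omega), hr 19 (by omega) (by omega), hr 20 (by omega) (by omega),
      hr 21 (by omega) (by omega), hr 22 (by omega) (by omega), hr 23 (by omega) (by omega),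
      hr 24 (by omega) (by omega)]
    exact h.attained

/-- Compare the pair of starting positions in the registers `16` and `17` with the best one. -/
def compareSplit : Prog :=
  arith add 45 15 17 ⨾ load 45 45 ⨾ branch (lt 12 45)
    (arith sub 45 45 3 ⨾ load 46 17 ⨾ arith add 47 13 45 ⨾ load 47 47 ⨾ arith add 48 46 47 ⨾
      arith add 48 48 3 ⨾ branch (lt 18 48)
        (copy 18 48 ⨾ copy 19 16 ⨾ copy 20 17 ⨾ copy 21 44 ⨾ copy 22 45 ⨾ copy 23 46 ⨾
          copy 24 47) skip) skip

/-- With the two rows for `i` in memory, the value of a pair takes constant time. A pair with `eB j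
= 0` has value `0` and may be passed over. -/
theorem wp_compareSplit {α : Type*} {w m n i j : ℕ} {x : Inp → List α} {f g : ℕ → ℕ → ℕ}
    {eA eB : ℕ → ℕ} {done : ℕ → ℕ → Prop} {σ : State α} {t : ℕ} (hf : IsGrid f) (hg : IsGrid g)
    (hw : m < 2 ^ w) (hm : 4 * (n + 1) < m) (h3 : σ.reg 3 = 1) (h12 : σ.reg 12 = 0)
    (h13 : σ.reg 13 = n + 1) (h15 : σ.reg 15 = 3 * (n + 1)) (h16 : σ.reg 16 = i)
    (h17 : σ.reg 17 = j) (h44 : eA i = σ.reg 44 + 1) (hi : i ≤ n) (hj : j ≤ n)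
    (heA : eA i ≤ n + 1) (heB : eB j ≤ n + 1) (hmemB : σ.mem (3 * (n + 1) + j) = eB j)
    (hrow : ∀ j, j ≤ n → σ.mem j = f i j)
    (hrow' : ∀ j, j ≤ n → σ.mem (n + 1 + j) = g (σ.reg 44) j)
    (h : IsBest n f g eA eB done σ.reg) :
    wp w m x compareSplit (fun τ t' => t' ≤ t + 17 ∧ τ.mem = σ.mem ∧
      IsBest n f g eA eB (fun i' j' => done i' j' ∨ (i' = i ∧ j' = j)) τ.reg) σ t := by
  have fi := hf.le_left i j
  have gi := hg.le_left (σ.reg 44) (eB j - 1)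
  unfold compareSplit
  simp [h3, h12, h13, h15, h16, h17, hmemB]
  refine ⟨by omega, by omega, fun hpos => ?_, fun hzero => ?_⟩
  · have hv : splitValue f g eA eB i j = f i j + g (σ.reg 44) (eB j - 1) + 1 := by
      rw [splitValue, if_neg (by omega), h44, Nat.add_sub_cancel]
    rw [hrow j hj, hrow' (eB j - 1) (by omega)]
    refine ⟨by omega, by omega, by omega, by omega, by omega, fun hlt => ⟨?_, ?_⟩,
      fun hle => ?_⟩
    · intro i' j' hi' hj' hd
      simp only [reg_setReg]
      simp
      rcases hd with hd | ⟨rfl, rfl⟩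
      · have := h.upper i' j' hi' hj' hd
        omega
      · omega
    · right
      simp
      omega
    · refine ⟨fun i' j' hi' hj' hd => ?_, by simpa using h.attained⟩
      simp
      rcases hd with hd | ⟨rfl, rfl⟩
      · exact h.upper i' j' hi' hj' hd
      · omega
  · refine h.congr (fun i' j' _ _ hd => ?_) (fun r hr hr' => by
      simp [show r ≠ 45 by omega])
    rcases hd with hd | ⟨rfl, rfl⟩
    · exact Or.inl hd
    · exact Or.inr (by rw [splitValue, if_pos (Or.inr hzero)])

/-- Find a pair of starting positions of maximal value. -/
def search : Prog :=
  const 16 0 ⨾ loop (lt 16 4)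
    (arith add 43 14 16 ⨾ load 43 43 ⨾ branch (lt 12 43)
      (arith sub 44 43 3 ⨾ copy 25 16 ⨾ copy 26 12 ⨾ copy 6 8 ⨾ copy 7 9 ⨾ fillRow ⨾
        copy 25 44 ⨾ copy 26 13 ⨾ copy 6 10 ⨾ copy 7 11 ⨾ fillRow ⨾
        const 17 0 ⨾ loop (lt 17 4) (compareSplit ⨾ arith add 17 17 3)) skip ⨾
      arith add 16 16 3)

/-- The row of `g` that is needed, number `eA i - 1`, depends only on `i`. Thus two restorations of
a row, of linear cost, serve for all `j`. -/
theorem wp_search {α : Type*} {w m n l D : ℕ} {x : Inp → List α} {f g : ℕ → ℕ → ℕ}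
    {eA eB : ℕ → ℕ} {σ : State α} {t : ℕ} (hL : HasTableAt w m (4 * (n + 1)) n l D f 8 9 σ)
    (hR : HasTableAt w m (4 * (n + 1)) n l D g 10 11 σ) (hm : 4 * (n + 1) < m)
    (h12 : σ.reg 12 = 0)
    (h13 : σ.reg 13 = n + 1) (h14 : σ.reg 14 = 2 * (n + 1)) (h15 : σ.reg 15 = 3 * (n + 1))
    (h18 : σ.reg 18 = 0) (heA : ∀ s, s ≤ n → eA s ≤ n + 1) (heB : ∀ s, s ≤ n → eB s ≤ n + 1)
    (hmemA : ∀ s, s ≤ n → σ.mem (2 * (n + 1) + s) = eA s)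
    (hmemB : ∀ s, s ≤ n → σ.mem (3 * (n + 1) + s) = eB s) :
    wp w m x search (fun τ t' => t' ≤ t + 2 + (n + 1) * ((n + 1) * 70 + 61) ∧
      (∀ a, 2 * (n + 1) ≤ a → τ.mem a = σ.mem a) ∧
      IsBest n f g eA eB (fun _ _ => True) τ.reg) σ t := by
  have h1 : σ.reg 1 = n := by simpa using hL.reg1
  have h3 : σ.reg 3 = 1 := by simpa using hL.reg3
  have h4 : σ.reg 4 = n + 1 := by simpa using hL.reg4
  have hw := hL.word
  have hf := hL.grid
  have hg := hR.grid
  unfold search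
  simp only [wp_seq, wp_const]
  refine ⟨by omega, ?_⟩
  refine wp_for ((n + 1) * 70 + 60) 0 (n + 1) (fun i ρ =>
    (∀ a, 2 * (n + 1) ≤ a → ρ.mem a = σ.mem a) ∧
    IsBest n f g eA eB (fun i' _ => i' < i) ρ.reg) (by simp) (by simp [h4]) (by omega) rfl
    ⟨by simp, by simp, by simp [h18]⟩ ?_ ?_
  · rintro i ρ t₁ hfr - hi hρi ⟨hmem, hbest⟩
    have r_le : ∀ r, r ≤ 15 → r ≠ 6 → r ≠ 7 → ρ.reg r = σ.reg r := fun r hr h6 h7 => by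
      rw [hfr.1 r (by interval_cases r <;> first | rfl | omega)]; simp [show r ≠ 16 by omega]
    have r3 := r_le 3 (by omega) (by omega) (by omega)
    have r12 := r_le 12 (by omega) (by omega) (by omega)
    have r14 := r_le 14 (by omega) (by omega) (by omega)
    have ha := hmemA i (by omega)
    rw [← hmem _ (by omega)] at ha
    simp only [wp_seq, wp_add, wp_load, wp_branch_lt]
    refine ⟨by simp [r14, h14, hρi]; omega, by simp [r14, h14, hρi]; omega, fun hpos => ?_,
      fun hzero => ?_⟩
    · simp [r12, h12, r14, h14, hρi, ha] at hpos
      have hTL : HasTableAt w m (4 * (n + 1)) n l D f 8 9 ρ := hL.congr (by omega) (by omega)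
        (by omega) (by omega) (by omega) (by omega) r_le (fun a ha => hmem a (by omega))
      simp only [wp_seq, wp_sub, wp_copy]
      have hbA := heA i (by omega)
      refine wp_conseq (wp_fillRow (i := i) (d := 0) (HasTable.congr hTL (fun r hr => ?_)
        (fun _ _ => rfl)) (by simp [hρi]) (by simp [r12, h12]) (by omega) (by omega)) ?_
      · simp [show r ≠ 26 by omega, show r ≠ 25 by omega, show r ≠ 44 by omega,
          show r ≠ 43 by omega]
      rintro τ t₂ hfr₂ ⟨ht₂, hrow, hmem₂⟩
      simp only [mem_setReg, Nat.zero_add] at hrow hmem₂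
      have q_le : ∀ r, r ≤ 24 → r ≠ 6 → r ≠ 7 → τ.reg r = ρ.reg r := fun r hr h6 h7 => by
        rw [hfr₂.1 r (by interval_cases r <;> rfl)]
        simp [show r ≠ 26 by omega, show r ≠ 25 by omega, show r ≠ 44 by omega,
          show r ≠ 43 by omega, h6, h7]
      have q44 : τ.reg 44 = eA i - 1 := by
        rw [hfr₂.1 44 rfl]; simp [r14, h14, hρi, ha, r3, h3]
      have hTR : HasTableAt w m (4 * (n + 1)) n l D g 10 11 τ := hR.congr (by omega) (by omega)
        (by omega) (by omega) (by omega) (by omega) (fun r hr h6 h7 => by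
          rw [q_le r (by omega) h6 h7, r_le r hr h6 h7]) (fun a ha => by
          rw [hmem₂ a (by omega), hmem a (by omega)])
      simp only [wp_seq, wp_copy]
      refine wp_conseq (wp_fillRow (i := eA i - 1) (d := n + 1) (HasTable.congr hTR
        (fun r hr => ?_) (fun _ _ => rfl)) (by simp [q44])
        (by simp [q_le 13, r_le 13, h13]) (by omega) (by omega)) ?_
      · simp [show r ≠ 26 by omega, show r ≠ 25 by omega]
      rintro υ t₃ hfr₃ ⟨ht₃, hrow₃, hmem₃⟩
      simp only [mem_setReg] at hrow₃ hmem₃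
      have p_le : ∀ r, r ≤ 24 → r ≠ 6 → r ≠ 7 → υ.reg r = ρ.reg r := fun r hr h6 h7 => by
        rw [hfr₃.1 r (by interval_cases r <;> rfl)]
        simp [show r ≠ 26 by omega, show r ≠ 25 by omega, h6, h7, q_le r hr h6 h7]
      have p44 : υ.reg 44 = eA i - 1 := by
        rw [hfr₃.1 44 rfl]; simp [q44]
      simp only [wp_seq, wp_const]
      refine ⟨by omega, ?_⟩
      refine wp_for 20 0 (n + 1) (fun j κ => κ.mem = υ.mem ∧
        IsBest n f g eA eB (fun i' j' => i' < i ∨ (i' = i ∧ j' < j)) κ.reg) (by simp)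
        (by simp [p_le 4, r_le 4, h4]) (by omega) rfl ⟨rfl, hbest.congr
          (fun i' j' _ _ h => Or.inl (by omega)) (fun r hr hr' => by
            simp [show r ≠ 17 by omega, p_le r (by omega) (by omega) (by omega)])⟩ ?_ ?_
      · rintro j κ t₄ hfr₄ - hj hκj ⟨hmem₄, hbest₄⟩
        have k_le : ∀ r, r ≤ 16 → r ≠ 6 → r ≠ 7 → κ.reg r = ρ.reg r := fun r hr h6 h7 => by
          rw [hfr₄.1 r (by interval_cases r <;> rfl)]
          simp [show r ≠ 17 by omega, p_le r (by omega) h6 h7]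
        have k44 : κ.reg 44 = eA i - 1 := by
          rw [hfr₄.1 44 rfl]; simp [p44]
        rw [wp_seq]
        refine wp_conseq (wp_compareSplit (n := n) (i := i) (j := j) (f := f) (g := g) (eA := eA)
          (eB := eB) hf hg hw hm
          (by simp [k_le 3, r_le 3, h3]) (by simp [k_le 12, r_le 12, h12])
          (by simp [k_le 13, r_le 13, h13]) (by simp [k_le 15, r_le 15, h15])
          (by simp [k_le 16, hρi]) hκj (by omega) (by omega) (by omega) (heA i (by omega))
          (heB j (by omega)) ?_ ?_ ?_ hbest₄) ?_
        · rw [hmem₄, hmem₃ _ (by omega), hmem₂ _ (by omega), hmem _ (by omega)]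
          exact hmemB j (by omega)
        · intro k hk
          rw [hmem₄, hmem₃ _ (by omega)]
          exact hrow k hk
        · intro k hk
          rw [hmem₄, k44]
          exact hrow₃ k hk
        rintro ν t₅ hfr₅ ⟨ht₅, hmem₅, hbest₅⟩
        have n3 : ν.reg 3 = 1 := by rw [hfr₅.1 3 rfl, k_le 3 (by omega) (by omega) (by omega), r3, h3]
        have n17 : ν.reg 17 = j := by rw [hfr₅.1 17 rfl, hκj]
        simp [n3, n17]
        exact ⟨by omega, by omega, by rw [hmem₅, hmem₄], hbest₅.congr
          (fun i' j' _ _ h => Or.inl (by omega)) (fun r hr hr' => by simp [show r ≠ 17 by omega])⟩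
      · rintro κ t₄ hfr₄ - ⟨hmem₄, hbest₄⟩ ht₄
        have k_le : ∀ r, r ≤ 16 → r ≠ 6 → r ≠ 7 → κ.reg r = ρ.reg r := fun r hr h6 h7 => by
          rw [hfr₄.1 r (by interval_cases r <;> rfl)]
          simp [show r ≠ 17 by omega, p_le r (by omega) h6 h7]
        simp [k_le 3, r3, h3, k_le 16, hρi]
        refine ⟨by omega, by omega, fun a ha => ?_, hbest₄.congr
          (fun i' j' _ _ h => Or.inl (by omega)) (fun r hr hr' => by simp [show r ≠ 16 by omega])⟩
        rw [hmem₄, hmem₃ a (by omega), hmem₂ a (by omega), hmem a ha]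
    · simp [r12, h12, r14, h14, hρi, ha] at hzero
      simp [hρi, r3, h3]
      refine ⟨by omega, by omega, hmem, hbest.congr (fun i' j' _ _ h => ?_) (fun r hr hr' => by
        simp [show r ≠ 16 by omega, show r ≠ 43 by omega])⟩
      rcases eq_or_ne i' i with rfl | hne
      · exact Or.inr (by rw [splitValue, if_pos (Or.inl hzero)])
      · exact Or.inl (by omega)
  · rintro ρ t₁ hfr - ⟨hmem, hbest⟩ ht₁
    rw [Nat.sub_zero, show (n + 1) * 70 + 60 + 1 = (n + 1) * 70 + 61 from rfl] at ht₁
    exact ⟨by omega, hmem, hbest.congr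
      (fun i' j' hi' _ _ => Or.inl (by omega)) (fun _ _ _ => rfl)⟩

/-! ### The output -/

/-- Copy the symbols of the first string at the positions in the memory cells below the address in
register `23` to the output. -/
def emitForward : Prog :=
  const 25 0 ⨾ loop (lt 25 23) (load 26 25 ⨾ emit Inp.A 26 ⨾ arith add 25 25 3)

/-- Copy the pattern to the output. -/
def emitPattern : Prog :=
  const 25 0 ⨾ loop (lt 25 2) (emit Inp.P 25 ⨾ arith add 25 25 3)

/-- Copy the symbols of the first string at the positions, counted from its end, in the memory cells
below the address in register `24` to the output, starting with the last cell. -/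
def emitBackward : Prog :=
  const 25 0 ⨾ loop (lt 25 24) (arith sub 26 24 3 ⨾ arith sub 26 26 25 ⨾ load 26 26 ⨾
    arith sub 26 1 26 ⨾ arith sub 26 26 3 ⨾ emit Inp.A 26 ⨾ arith add 25 25 3)

theorem wp_emitForward {α : Type*} {w m n : ℕ} {x : Inp → List α} {A Z : List α} {σ : State α}
    {t : ℕ} (hx : x Inp.A = A) (hA : A.length = n) (hw : m < 2 ^ w) (hm : Z.length < m)
    (h3 : σ.reg 3 = 1) (h23 : σ.reg 23 = Z.length)
    (hZ : ∀ k, k < Z.length → σ.mem k < n ∧ A[σ.mem k]? = Z[k]?) :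
    wp w m x emitForward (fun τ t' => t' ≤ t + 2 + Z.length * 4 ∧ τ.mem = σ.mem ∧
      τ.out = σ.out ++ Z) σ t := by
  unfold emitForward
  simp only [wp_seq, wp_const]
  refine ⟨by omega, wp_for 3 0 Z.length (fun i ρ => ρ.mem = σ.mem ∧ ρ.out = σ.out ++ Z.take i)
    (by simp) (by simp [h23]) (by omega) rfl (by simp) ?_ ?_⟩
  · rintro i ρ s hfr - hi hρi ⟨hmem, hout⟩
    have r3 : ρ.reg 3 = 1 := by simpa [h3] using hfr.1 3 rfl
    obtain ⟨hz1, hz2⟩ := hZ i hi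
    simp [hρi, r3, hx, hA, hmem, hz1, hout]
    rw [List.getElem?_eq_getElem (by omega), List.getElem?_eq_getElem hi,
      Option.some.injEq] at hz2
    refine ⟨by omega, by omega, ?_⟩
    rw [List.take_add_one, List.getElem?_eq_getElem hi, hz2]
    rfl
  · rintro ρ s hfr - ⟨hmem, hout⟩ hs
    exact ⟨by omega, hmem, by simpa using hout⟩

theorem wp_emitPattern {α : Type*} {w m : ℕ} {x : Inp → List α} {P : List α} {σ : State α}
    {t : ℕ} (hx : x Inp.P = P) (hw : P.length + 1 < 2 ^ w)
    (h3 : σ.reg 3 = 1) (h2 : σ.reg 2 = P.length) :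
    wp w m x emitPattern (fun τ t' => t' ≤ t + 2 + P.length * 3 ∧ τ.mem = σ.mem ∧
      τ.out = σ.out ++ P) σ t := by
  unfold emitPattern
  simp only [wp_seq, wp_const]
  refine ⟨by omega, wp_for 2 0 P.length (fun i ρ => ρ.mem = σ.mem ∧ ρ.out = σ.out ++ P.take i)
    (by simp) (by simp [h2]) (by omega) rfl (by simp) ?_ ?_⟩
  · rintro i ρ s hfr - hi hρi ⟨hmem, hout⟩
    have r3 : ρ.reg 3 = 1 := by simpa [h3] using hfr.1 3 rfl
    simp [hρi, r3, hx, hmem, hi, hout]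
    omega
  · rintro ρ s hfr - ⟨hmem, hout⟩ hs
    exact ⟨by omega, hmem, by simpa using hout⟩

/-- The trace ran in the reversed string: its order has to be inverted, and its position `k` is the
position `n - 1 - k` of `A`. -/
theorem wp_emitBackward {α : Type*} {w m n : ℕ} {x : Inp → List α} {A Z : List α} {σ : State α}
    {t : ℕ} (hx : x Inp.A = A) (hA : A.length = n) (hw : m < 2 ^ w) (hm : Z.length < m)
    (h1 : σ.reg 1 = n) (h3 : σ.reg 3 = 1) (h24 : σ.reg 24 = Z.length)
    (hZ : ∀ k, k < Z.length → σ.mem k < n ∧ A.reverse[σ.mem k]? = Z[k]?) :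
    wp w m x emitBackward (fun τ t' => t' ≤ t + 2 + Z.length * 8 ∧ τ.mem = σ.mem ∧
      τ.out = σ.out ++ Z.reverse) σ t := by
  unfold emitBackward
  simp only [wp_seq, wp_const]
  refine ⟨by omega, wp_for 7 0 Z.length
    (fun i ρ => ρ.mem = σ.mem ∧ ρ.out = σ.out ++ Z.reverse.take i)
    (by simp) (by simp [h24]) (by omega) rfl (by simp) ?_ ?_⟩
  · rintro i ρ s hfr - hi hρi ⟨hmem, hout⟩
    have r1 : ρ.reg 1 = n := by simpa [h1] using hfr.1 1 rfl
    have r3 : ρ.reg 3 = 1 := by simpa [h3] using hfr.1 3 rfl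
    have r24 : ρ.reg 24 = Z.length := by simpa [h24] using hfr.1 24 rfl
    obtain ⟨hz1, hz2⟩ := hZ (Z.length - 1 - i) (by omega)
    rw [List.getElem?_reverse (by omega), hA] at hz2
    have he : n - σ.mem (Z.length - 1 - i) - 1 = n - 1 - σ.mem (Z.length - 1 - i) := by omega
    simp only [wp_seq, wp_sub, wp_load, wp_emit, wp_add]
    simp only [reg_setReg, mem_setReg, out_setReg, hρi, r1, r3, r24, hx, hmem, hout]
    simp
    refine ⟨by omega, by omega, by omega, ?_⟩
    rw [he, hz2, List.take_add_one, List.getElem?_reverse hi]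
  · rintro ρ s hfr - ⟨hmem, hout⟩ hs
    rw [← List.length_reverse, List.take_length] at hout
    exact ⟨by omega, hmem, hout⟩

/-- Write the solution that belongs to the best pair of starting positions to the output, and its
length plus one into register `0`. -/
def finish : Prog :=
  copy 30 19 ⨾ copy 31 20 ⨾ copy 32 23 ⨾ copy 6 8 ⨾ copy 7 9 ⨾ traceBack ⨾
    emitForward ⨾ emitPattern ⨾ copy 30 21 ⨾ copy 31 22 ⨾ copy 32 24 ⨾ copy 6 10 ⨾ copy 7 11 ⨾
    traceBack ⨾ emitBackward ⨾ arith add 0 18 2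

/-- The first part is emitted before the second trace reuses its cells. Every competitor belongs to
a pair of cuts, whose value is dominated by register `18`. The `+ 1` in the values is the `+ 1` of
the encoded length, so adding `|P|` yields register `0`. -/
theorem wp_finish {α : Type*} {w m n l D : ℕ} {A B P : List α} {eA eB : ℕ → ℕ} {σ : State α}
    {t : ℕ} (hA : A.length = n) (hB : B.length = n) (hr : P.length ≤ n)
    (hL : HasTableAt w m (4 * (n + 1)) n l D (prefixLcs A B) 8 9 σ)
    (hR : HasTableAt w m (4 * (n + 1)) n l D (prefixLcs A.reverse B.reverse) 10 11 σ)
    (hm : 4 * (n + 1) < m) (h2 : σ.reg 2 = P.length) (h12 : σ.reg 12 = 0)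
    (heA : ∀ s, s ≤ n → IsEnd P A s (eA s)) (heB : ∀ s, s ≤ n → IsEnd P B s (eB s))
    (hbest : IsBest n (prefixLcs A B) (prefixLcs A.reverse B.reverse) eA eB (fun _ _ => True)
      σ.reg) (hpos : 0 < σ.reg 18) (hout : σ.out = []) :
    wp w m (input A B P) finish (fun τ t' => t' ≤ t + 30 + n * 220 ∧ IsAnswer A B P τ) σ t := by
  have h1 : σ.reg 1 = n := by simpa using hL.reg1
  have h3 : σ.reg 3 = 1 := by simpa using hL.reg3
  have hw := hL.word
  have hf := hL.grid
  have hg := hR.grid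
  rcases hbest.attained with h0 | ⟨h19, h20, h21, h22, h23, h24, h18⟩
  · omega
  have eA_le : eA (σ.reg 19) ≤ n + 1 := by rcases heA _ h19 with h | ⟨e, h⟩ <;> omega
  have eB_le : eB (σ.reg 20) ≤ n + 1 := by rcases heB _ h20 with h | ⟨e, h⟩ <;> omega
  have l23 := hf.le_left (σ.reg 19) (σ.reg 20)
  have l24 := hg.le_left (σ.reg 21) (σ.reg 22)
  unfold finish
  simp only [wp_seq, wp_copy]
  refine wp_conseq (wp_traceBack (U := A) (V := B) (s₀ := σ.reg 23) (i₀ := σ.reg 19)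
    (j₀ := σ.reg 20) (HasTable.congr hL (fun r hr => ?_)
    (fun _ _ => rfl)) hA hB (by simp [h12]) (by simp) (by simp) (by simp) h19 h20 h23
    (by omega)) ?_
  · simp [show r ≠ 32 by omega, show r ≠ 31 by omega, show r ≠ 30 by omega]
  rintro ρ t₁ hfr₁ ⟨ht₁, hmem₁, X, hX, hXA, hXB, hXm⟩
  simp only [mem_setReg] at hmem₁
  have r_le : ∀ r, r ≤ 24 → r ≠ 6 → r ≠ 7 → ρ.reg r = σ.reg r := fun r hr h6 h7 => by
    rw [hfr₁.1 r (by interval_cases r <;> rfl)]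
    simp [show r ≠ 32 by omega, show r ≠ 31 by omega, show r ≠ 30 by omega, h6, h7]
  have hout₁ : ρ.out = [] := by rw [hfr₁.2 rfl]; simpa using hout
  rw [wp_seq]
  refine wp_conseq (wp_emitForward (A := A) (Z := X) (n := n) rfl hA hw (by omega)
    (by simp [r_le 3, h3]) (by simp [r_le 23, hX]) (by rwa [hX])) ?_
  rintro τ t₂ hfr₂ ⟨ht₂, hmem₂, hout₂⟩
  have q_le : ∀ r, r ≤ 24 → r ≠ 6 → r ≠ 7 → τ.reg r = σ.reg r := fun r hr h6 h7 => by
    rw [hfr₂.1 r (by interval_cases r <;> rfl), r_le r hr h6 h7]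
  rw [wp_seq]
  refine wp_conseq (wp_emitPattern (P := P) rfl (by omega) (by simp [q_le 3, h3])
    (by simp [q_le 2, h2])) ?_
  rintro υ t₃ hfr₃ ⟨ht₃, hmem₃, hout₃⟩
  have p_le : ∀ r, r ≤ 24 → r ≠ 6 → r ≠ 7 → υ.reg r = σ.reg r := fun r hr h6 h7 => by
    rw [hfr₃.1 r (by interval_cases r <;> rfl), q_le r hr h6 h7]
  have hR' : HasTableAt w m (4 * (n + 1)) n l D (prefixLcs A.reverse B.reverse) 10 11 υ :=
    hR.congr (by omega) (by omega) (by omega) (by omega) (by omega) (by omega)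
      (fun r hr => p_le r (by omega)) (fun a ha => by rw [hmem₃, hmem₂, hmem₁ a ha])
  simp only [wp_seq, wp_copy]
  refine wp_conseq (wp_traceBack (U := A.reverse) (V := B.reverse) (s₀ := σ.reg 24)
    (i₀ := σ.reg 21) (j₀ := σ.reg 22) (HasTable.congr hR' (fun r hr => ?_)
    (fun _ _ => rfl)) (by simpa using hA) (by simpa using hB) (by simp [p_le 12, h12])
    (by simp [p_le 21]) (by simp [p_le 22]) (by simp [p_le 24]) (by omega) (by omega) h24
    (by omega)) ?_
  · simp [show r ≠ 32 by omega, show r ≠ 31 by omega, show r ≠ 30 by omega]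
  rintro κ t₄ hfr₄ ⟨ht₄, -, Y, hY, hYA, hYB, hYm⟩
  have k_le : ∀ r, r ≤ 24 → r ≠ 6 → r ≠ 7 → κ.reg r = σ.reg r := fun r hr h6 h7 => by
    rw [hfr₄.1 r (by interval_cases r <;> rfl)]
    simp [show r ≠ 32 by omega, show r ≠ 31 by omega, show r ≠ 30 by omega, h6, h7, p_le r hr]
  have hout₄ : κ.out = υ.out := by rw [hfr₄.2 rfl]; rfl
  rw [wp_seq]
  refine wp_conseq (wp_emitBackward (A := A) (Z := Y) (n := n) rfl hA hw (by omega)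
    (by simp [k_le 1, h1]) (by simp [k_le 3, h3]) (by simp [k_le 24, hY]) (by rwa [hY])) ?_
  rintro ν t₅ hfr₅ ⟨ht₅, -, hout₅⟩
  have n_le : ∀ r, r ≤ 24 → r ≠ 6 → r ≠ 7 → ν.reg r = σ.reg r := fun r hr h6 h7 => by
    rw [hfr₅.1 r (by interval_cases r <;> rfl), k_le r hr h6 h7]
  have hZ : ν.out = X ++ (P ++ Y.reverse) := by
    rw [hout₅, hout₄, hout₃, hout₂, hout₁, List.nil_append, List.append_assoc]
  have hlen : ν.out.length + 1 = σ.reg 18 + P.length := by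
    rw [hZ, h18, ← hX, ← hY]
    simp only [List.length_append, List.length_reverse]
    omega
  rw [wp_add, n_le 18 (by omega) (by omega) (by omega), n_le 2 (by omega) (by omega) (by omega),
    h2]
  refine ⟨by omega, by omega, Or.inl ⟨⟨?_, fun Z' hZ' => ?_⟩, by simp [hlen]⟩⟩
  · rw [out_setReg, hZ]
    refine isFeasible_of_isEnd (heA _ h19) (heB _ h20) (by omega) (by omega) hXA hXB ?_ ?_
    · rw [h21]; exact hYA
    · rw [h22]; exact hYB
  · obtain ⟨i, j, hi, hj, hle, -⟩ := hZ'.exists_splitValue hA hB heA heB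
    have := hbest.upper i j hi hj trivial
    rw [out_setReg]
    omega

/-! ### The complete program -/

/-- Fill the tables for the strings and for the reversed strings. -/
def buildTables : Prog :=
  copy 13 4 ⨾ arith add 14 4 4 ⨾ arith add 15 14 4 ⨾ arith add 6 15 4 ⨾ copy 7 6 ⨾
    fillTable false ⨾ load 16 1 ⨾ arith sub 5 4 16 ⨾ arith add 16 16 3 ⨾ arith add 16 16 3 ⨾
    arith mul 16 16 5 ⨾ copy 8 6 ⨾ arith add 9 8 16 ⨾ arith add 10 9 16 ⨾ arith add 11 10 16 ⨾
    copy 7 9 ⨾ fillTable false ⨾ copy 6 10 ⨾ copy 7 11 ⨾ fillTable true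

/-- The size of the working memory. -/
def memSize (n l : ℕ) : ℕ := 4 * (n + 1) + 4 * ((l + 2) * (n + 1 - l))

-- The first pass runs with `D = 0` and tables of size `0`; it only delivers `l` in cell `n`, after
-- which width and addresses can be computed. Below the tables lie four blocks of `n + 1` words: two
-- for rows, two for the greedy ends. Each half has `l + 2` levels, since level `0` is left unused
-- and level `l + 1` is queried.
set_option maxHeartbeats 1000000 in
theorem wp_buildTables {α : Type*} {w m n l : ℕ} {A B P : List α} {σ : State α} {t : ℕ}
    (hA : A.length = n) (hB : B.length = n) (hl : l = lcs A B) (hm : m = memSize n l)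
    (hw : m < 2 ^ w) (h1 : σ.reg 1 = n) (h3 : σ.reg 3 = 1) (h4 : σ.reg 4 = n + 1)
    (h5 : σ.reg 5 = 0) (h12 : σ.reg 12 = 0) (hz : ∀ a, σ.mem a = 0) :
    wp w m (input A B P) buildTables (fun τ t' => t' ≤ t + 100 + n * 60 + n * (n * 93) ∧
      HasTableAt w m (4 * (n + 1)) n l (n + 1 - l) (prefixLcs A B) 8 9 τ ∧
      HasTableAt w m (4 * (n + 1)) n l (n + 1 - l) (prefixLcs A.reverse B.reverse) 10 11 τ ∧
      τ.reg 13 = n + 1 ∧ τ.reg 14 = 2 * (n + 1) ∧ τ.reg 15 = 3 * (n + 1)) σ t := by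
  have hf := isGrid_prefixLcs A B
  have hg := isGrid_prefixLcs A.reverse B.reverse
  have hfl : prefixLcs A B n n = l := by rw [hl, lcs_eq_prefixLcs hA hB]
  have hgl : prefixLcs A.reverse B.reverse n n = l := by
    rw [hl, ← lcs_reverse, lcs_eq_prefixLcs (by simpa using hA) (by simpa using hB)]
  have hln : l ≤ n := hfl ▸ hf.le_left n n
  obtain ⟨D, hD⟩ : ∃ D, n + 1 - l = D := ⟨_, rfl⟩
  obtain ⟨S, hS⟩ : ∃ S, (l + 2) * D = S := ⟨_, rfl⟩
  have hS2 : l + 2 ≤ S := by rw [← hS]; exact Nat.le_mul_of_pos_right _ (by omega)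
  have hDS : D ≤ S := by rw [← hS]; exact Nat.le_mul_of_pos_left _ (by omega)
  have hS' : (l + 1) * D ≤ S := by rw [← hS]; exact Nat.mul_le_mul_right D (by omega)
  rw [memSize, hD, hS] at hm
  rw [hD]
  unfold buildTables
  simp only [wp_seq, wp_copy, wp_add]
  simp only [reg_setReg]
  simp only [h4]
  simp
  refine ⟨by omega, by omega, by omega, ?_⟩
  refine wp_conseq (wp_fillTable (rev := false) (n := n) (D := 0) (S := 0)
    (b := 4 * (n + 1)) (b' := 4 * (n + 1)) hA hB rfl hw (by omega)
    (by simp [h1]) (by simp [h3]) (by simp [h4]) (by simp [h5]) (by simp; omega) (by simp; omega)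
    (by simp [h12]) (by omega) (by omega) (by omega) (by omega) (by omega) (by omega)) ?_
  rintro ρ t₁ hfr₁ ⟨ht₁, hcorner, hmem₁, -⟩
  have r1 : ρ.reg 1 = n := by rw [hfr₁.1 1 rfl]; simp [h1]
  have r3 : ρ.reg 3 = 1 := by rw [hfr₁.1 3 rfl]; simp [h3]
  have r4 : ρ.reg 4 = n + 1 := by rw [hfr₁.1 4 rfl]; simp [h4]
  have r6 : ρ.reg 6 = 4 * (n + 1) := by rw [hfr₁.1 6 rfl]; simp; omega
  have r12 : ρ.reg 12 = 0 := by rw [hfr₁.1 12 rfl]; simp [h12]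
  have r13 : ρ.reg 13 = n + 1 := by rw [hfr₁.1 13 rfl]; simp
  have r14 : ρ.reg 14 = 2 * (n + 1) := by rw [hfr₁.1 14 rfl]; simp; omega
  have r15 : ρ.reg 15 = 3 * (n + 1) := by rw [hfr₁.1 15 rfl]; simp; omega
  change ρ.mem n = prefixLcs A B n n at hcorner
  rw [hfl] at hcorner
  have z₁ : ∀ a, n < a → ρ.mem a = 0 := fun a ha => by
    rw [hmem₁ a ha (by omega) (by omega)]; simp [hz]
  simp only [wp_seq, wp_load, wp_add, wp_sub, wp_mul, wp_copy]
  simp only [reg_setReg]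
  simp only [r1, r3, r4, r6, hcorner]
  simp
  simp only [hD, hS]
  refine ⟨by omega, by omega, by omega, by omega, by omega, by omega, by omega, ?_⟩
  refine wp_conseq (wp_fillTable (rev := false) (n := n) (D := D) (S := S)
    (b := 4 * (n + 1)) (b' := 4 * (n + 1) + S) (f := prefixLcs A B) hA hB rfl hw (by omega)
    (by simp [r1]) (by simp [r3]) (by simp [r4]) (by simp) (by simp [r6]) (by simp)
    (by simp [r12]) (by omega) (by omega) (by omega) (by rwa [hfl])
    (fun a ha _ => z₁ a (by omega)) (fun a ha _ => z₁ a (by omega))) ?_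
  rintro τ t₂ hfr₂ ⟨ht₂, -, hmem₂, J, J', hJ, hJ', hmark, hmark'⟩
  simp only [mem_setReg] at hmem₂
  have hTL := isTable_of_marked (l := l) hf hS.le hJ hJ' hmark hmark'
  have q1 : τ.reg 1 = n := by rw [hfr₂.1 1 rfl]; simp [r1]
  have q3 : τ.reg 3 = 1 := by rw [hfr₂.1 3 rfl]; simp [r3]
  have q4 : τ.reg 4 = n + 1 := by rw [hfr₂.1 4 rfl]; simp [r4]
  have q5 : τ.reg 5 = D := by rw [hfr₂.1 5 rfl]; simp
  have q8 : τ.reg 8 = 4 * (n + 1) := by rw [hfr₂.1 8 rfl]; simp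
  have q9 : τ.reg 9 = 4 * (n + 1) + S := by rw [hfr₂.1 9 rfl]; simp
  have q10 : τ.reg 10 = 4 * (n + 1) + S + S := by rw [hfr₂.1 10 rfl]; simp
  have q11 : τ.reg 11 = 4 * (n + 1) + S + S + S := by rw [hfr₂.1 11 rfl]; simp
  have q12 : τ.reg 12 = 0 := by rw [hfr₂.1 12 rfl]; simp [r12]
  have q13 : τ.reg 13 = n + 1 := by rw [hfr₂.1 13 rfl]; simp [r13]
  have q14 : τ.reg 14 = 2 * (n + 1) := by rw [hfr₂.1 14 rfl]; simp [r14]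
  have q15 : τ.reg 15 = 3 * (n + 1) := by rw [hfr₂.1 15 rfl]; simp [r15]
  have z₂ : ∀ a, 4 * (n + 1) + S + S ≤ a → τ.mem a = 0 := fun a ha => by
    rw [hmem₂ a (by omega) (by omega) (by omega), z₁ a (by omega)]
  simp only [wp_seq, wp_copy]
  refine wp_conseq (wp_fillTable (rev := true) (n := n) (D := D) (S := S)
    (b := 4 * (n + 1) + S + S) (b' := 4 * (n + 1) + S + S + S)
    (f := prefixLcs A.reverse B.reverse) hA hB rfl hw (by omega)
    (by simp [q1]) (by simp [q3]) (by simp [q4]) (by simp [q5]) (by simp [q10]) (by simp [q11])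
    (by simp [q12]) (by omega) (by omega) (by omega) (by rwa [hgl])
    (fun a ha _ => z₂ a (by omega)) (fun a ha _ => z₂ a (by omega))) ?_
  rintro υ t₃ hfr₃ ⟨ht₃, -, hmem₃, J₃, J₃', hJ₃, hJ₃', hmark₃, hmark₃'⟩
  simp only [mem_setReg] at hmem₃
  have hTR := isTable_of_marked (l := l) hg hS.le hJ₃ hJ₃' hmark₃ hmark₃'
  have p_eq : ∀ r, r ≤ 15 → r ≠ 6 → r ≠ 7 → υ.reg r = τ.reg r := fun r hr h6 h7 => by
    rw [hfr₃.1 r (by interval_cases r <;> rfl)]; simp [h6, h7]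
  have hTL' : IsTable n l D (prefixLcs A B) υ.mem (4 * (n + 1)) (4 * (n + 1) + S) :=
    hTL.congr (fun a _ _ => hmem₃ a (by omega) (by omega) (by omega))
      (fun a _ _ => hmem₃ a (by omega) (by omega) (by omega))
  have ht : n * (n * 93) = 3 * (n * (n * 31)) := by ring
  refine ⟨by omega, ?_, ?_, by rw [p_eq 13 (by omega) (by omega) (by omega), q13],
    by rw [p_eq 14 (by omega) (by omega) (by omega), q14],
    by rw [p_eq 15 (by omega) (by omega) (by omega), q15]⟩
  · constructor
    all_goals try simp [p_eq, q1, q3, q4, q5, q8, q9, hS]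
    all_goals first | assumption | omega
  · constructor
    all_goals try simp [p_eq, q1, q3, q4, q5, q10, q11, hS]
    all_goals first | assumption | omega

/-- The program that solves the STR-IC-LCS problem. -/
def solve : Prog :=
  len 1 Inp.A ⨾ len 2 Inp.P ⨾ const 3 1 ⨾ arith add 4 1 3 ⨾ branch (lt 1 2) skip
    (buildTables ⨾ scan Inp.A 14 ⨾ scan Inp.B 15 ⨾ search ⨾ branch (lt 12 18) finish skip)

/-- If `|P| > n`, the initial state is already the negative answer. Otherwise register `18` is
positive exactly if some pair has positive value, and only then is anything emitted. -/
theorem wp_solve {α : Type*} {w m n l : ℕ} {A B P : List α}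
    (hA : A.length = n) (hB : B.length = n) (hl : l = lcs A B) (hm : m = memSize n l)
    (hw : m < 2 ^ w) (hP : P.length < 2 ^ w) :
    wp w m (input A B P) solve (fun τ t => t ≤ 2000 * (n ^ 2 + 1) ∧ IsAnswer A B P τ)
      (State.init α) 0 := by
  have hln : l ≤ n := by
    rw [hl, lcs_eq_prefixLcs hA hB]; exact (isGrid_prefixLcs A B).le_left n n
  have hS2 : l + 2 ≤ (l + 2) * (n + 1 - l) := Nat.le_mul_of_pos_right _ (by omega)
  have hm4 : 4 * (n + 1) < m := by rw [hm, memSize]; omega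
  have hsq : n ≤ n ^ 2 := Nat.le_self_pow (by omega) n
  unfold solve
  simp only [wp_seq, wp_len, wp_const, wp_add]
  refine ⟨by simp [input, hA]; omega, by simpa [input] using hP, by omega, ?_, ?_⟩
  · simp [input, hA]; omega
  simp only [input, hA]
  rw [wp_branch_lt]
  simp only [reg_setReg]
  simp
  refine ⟨fun hlt => ⟨by omega, Or.inr ⟨fun Z hZ => ?_, rfl, rfl⟩⟩, fun hle => ?_⟩
  · have h1 := hZ.1.length_le
    have h2 := hZ.2.1.length_le
    omega
  refine wp_conseq (wp_buildTables hA hB hl hm hw (by simp) (by simp) (by simp)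
    (by simp [State.init]) (by simp [State.init]) (by simp [State.init])) ?_
  rintro ρ t₁ hfr₁ ⟨ht₁, hL, hR, h13, h14, h15⟩
  have r2 : ρ.reg 2 = P.length := by rw [hfr₁.1 2 rfl]; simp
  have r0 : ρ.reg 0 = 0 := by rw [hfr₁.1 0 rfl]; simp [State.init]
  have r12 : ρ.reg 12 = 0 := by rw [hfr₁.1 12 rfl]; simp [State.init]
  have r18 : ρ.reg 18 = 0 := by rw [hfr₁.1 18 rfl]; simp [State.init]
  have o₁ : ρ.out = [] := by rw [hfr₁.2 rfl]; simp [State.init]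
  have r1 : ρ.reg 1 = n := by simpa using hL.reg1
  have r3 : ρ.reg 3 = 1 := by simpa using hL.reg3
  have r4 : ρ.reg 4 = n + 1 := by simpa using hL.reg4
  rw [wp_seq]
  refine wp_conseq (wp_scan (u := Inp.A) (U := A) (P := P) rfl rfl hA rfl hw hle r1 r2 r3 r4 r12
    (by omega) (by omega)) ?_
  rintro τ t₂ hfr₂ ⟨ht₂, heA, hmem₂⟩
  have q_le : ∀ r, r ≤ 24 → τ.reg r = ρ.reg r := fun r hr =>
    hfr₂.1 r (by interval_cases r <;> rfl)
  rw [h14] at heA hmem₂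
  rw [wp_seq]
  refine wp_conseq (wp_scan (u := Inp.B) (U := B) (P := P) rfl rfl hB rfl hw hle
    (by rw [q_le 1 (by omega), r1]) (by rw [q_le 2 (by omega), r2]) (by rw [q_le 3 (by omega), r3])
    (by rw [q_le 4 (by omega), r4]) (by rw [q_le 12 (by omega), r12])
    (by omega) (by rw [q_le 15 (by omega)]; omega)) ?_
  rintro υ t₃ hfr₃ ⟨ht₃, heB, hmem₃⟩
  have p_le : ∀ r, r ≤ 24 → υ.reg r = ρ.reg r := fun r hr => by
    rw [hfr₃.1 r (by interval_cases r <;> rfl), q_le r hr]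
  rw [q_le 15 (by omega), h15] at heB hmem₃
  have heA' : ∀ s, s ≤ n → IsEnd P A s (υ.mem (2 * (n + 1) + s)) := fun s hs => by
    rw [hmem₃ _ (by omega)]; exact heA s hs
  have hmemρ : ∀ a, 4 * (n + 1) ≤ a → υ.mem a = ρ.mem a := fun a ha => by
    rw [hmem₃ _ (by omega), hmem₂ _ (by omega)]
  have bound : ∀ (U : List α) s v, U.length = n → IsEnd P U s v → v ≤ n + 1 := by
    rintro U s v hU (h | ⟨e, h⟩) <;> omega
  rw [wp_seq]
  refine wp_conseq (wp_search (eA := fun s => υ.mem (2 * (n + 1) + s))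
    (eB := fun s => υ.mem (3 * (n + 1) + s))
    (hL.congr (by omega) (by omega) (by omega) (by omega) (by omega) (by omega)
      (fun r hr _ _ => p_le r (by omega)) hmemρ)
    (hR.congr (by omega) (by omega) (by omega) (by omega) (by omega) (by omega)
      (fun r hr _ _ => p_le r (by omega)) hmemρ) hm4 (by rw [p_le 12 (by omega), r12])
    (by rw [p_le 13 (by omega), h13]) (by rw [p_le 14 (by omega), h14])
    (by rw [p_le 15 (by omega), h15]) (by rw [p_le 18 (by omega), r18])
    (fun s hs => bound A s _ hA (heA' s hs)) (fun s hs => bound B s _ hB (heB s hs))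
    (fun _ _ => rfl) (fun _ _ => rfl)) ?_
  rintro κ t₄ hfr₄ ⟨ht₄, hmem₄, hbest⟩
  have k_le : ∀ r, r ≤ 15 → r ≠ 6 → r ≠ 7 → κ.reg r = ρ.reg r := fun r hr h6 h7 => by
    rw [hfr₄.1 r (by interval_cases r <;> first | rfl | omega), p_le r (by omega)]
  have o₄ : κ.out = [] := by rw [hfr₄.2 rfl, hfr₃.2 rfl, hfr₂.2 rfl, o₁]
  have e₂ : (n + 1) * (n * 7 + 12) = 7 * n ^ 2 + 19 * n + 12 := by ring
  have e₄ : (n + 1) * ((n + 1) * 70 + 61) = 70 * n ^ 2 + 201 * n + 131 := by ring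
  have e₁ : n * (n * 93) = 93 * n ^ 2 := by ring
  rw [wp_branch_lt, k_le 12 (by omega) (by omega) (by omega), r12]
  refine ⟨fun hpos => ?_, fun hneg => ?_⟩
  · refine wp_mono (wp_finish hA hB hle (D := n + 1 - l) (l := l) ?_ ?_ hm4
      (by rw [k_le 2 (by omega) (by omega) (by omega), r2])
      (by rw [k_le 12 (by omega) (by omega) (by omega), r12]) heA' heB hbest hpos o₄) ?_
    · exact hL.congr (by omega) (by omega) (by omega) (by omega) (by omega) (by omega) k_le
        (fun a ha => by rw [hmem₄ a (by omega), hmemρ a ha])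
    · exact hR.congr (by omega) (by omega) (by omega) (by omega) (by omega) (by omega) k_le
        (fun a ha => by rw [hmem₄ a (by omega), hmemρ a ha])
    · rintro ν t₅ ⟨ht₅, hans⟩
      exact ⟨by omega, hans⟩
  · rw [wp_skip]
    refine ⟨by omega, Or.inr ⟨fun Z hZ => ?_, o₄,
      by rw [k_le 0 (by omega) (by omega) (by omega), r0]⟩⟩
    obtain ⟨i, j, hi, hj, -, hne⟩ := hZ.exists_splitValue hA hB heA' heB
    have := hbest.upper i j hi hj trivial
    omega

set_option maxRecDepth 10000 in
theorem numRegs_solve : solve.numRegs = 49 := by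
  rfl

theorem solvesWithin_solve {α : Type*} {n w : ℕ} {A B P : List α} (hA : A.length = n)
    (hB : B.length = n) (hP : P.length < 2 ^ w) (hw : 2000 * (n + 1) ^ 2 ≤ 2 ^ w) :
    SolvesWithin solve w A B P (2000 * (n ^ 2 + 1))
      (2000 * ((lcs A B + 1) * (n - lcs A B + 1))) := by
  obtain ⟨l, hl⟩ : ∃ l, l = lcs A B := ⟨_, rfl⟩
  have hln : l ≤ n := by
    rw [hl, lcs_eq_prefixLcs hA hB]; exact (isGrid_prefixLcs A B).le_left n n
  obtain ⟨d, rfl⟩ : ∃ d, n = l + d := ⟨n - l, by omega⟩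
  -- `l + d + 1 ≤ (l + 1) * (d + 1)` accounts for `4`, and `l + 2 ≤ 2 * (l + 1)` for `8`.
  have hsize : memSize (l + d) l ≤ 12 * ((l + 1) * (d + 1)) := by
    rw [memSize, show l + d + 1 - l = d + 1 by omega]
    nlinarith [Nat.zero_le (l * d)]
  have hmw : memSize (l + d) l < 2 ^ w := by
    refine lt_of_lt_of_le ?_ hw
    nlinarith [Nat.zero_le (l * d)]
  obtain ⟨t, τ, hexec, ht, hans⟩ := exec_of_wp (wp_solve hA hB hl rfl hmw hP)
  refine ⟨_, t, τ, hexec, hans, by simpa using ht, ?_⟩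
  rw [numRegs_solve, ← hl, show l + d - l + 1 = d + 1 by omega]
  have : 1 ≤ (l + 1) * (d + 1) := Nat.succ_le_of_lt (by positivity)
  omega

end StrIcLcs

theorem theorem1 :
    ∃ (p : StrIcLcs.Prog) (C : ℕ),
      (∀ (α : Type u) (n w : ℕ) (A B P : List α),
        A.length = n → B.length = n → P.length < 2 ^ w → C * (n + 1) ^ 2 ≤ 2 ^ w →
        StrIcLcs.SolvesWithin p w A B P
          (C * (n ^ 2 + 1))
          (C * ((StrIcLcs.lcs A B + 1) * (n - StrIcLcs.lcs A B + 1)))) ∧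
      (∀ c : ℕ, ∃ K : ℕ, ∀ (α : Type u) (n w : ℕ) (A B P : List α),
        A.length = n → B.length = n → P.length < 2 ^ w → C * (n + 1) ^ 2 ≤ 2 ^ w →
        (StrIcLcs.lcs A B ≤ c ∨ n - StrIcLcs.lcs A B ≤ c) →
        StrIcLcs.SolvesWithin p w A B P
          (C * (n ^ 2 + 1))
          (K * (n + 1))) := by
  -- One factor of the space bound is at most `c + 1` and the other always at most `n + 1`, whence
  -- `K = 2000 * (c + 1)`.
  refine ⟨StrIcLcs.solve, 2000, fun α n w A B P hA hB hP hw =>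
    StrIcLcs.solvesWithin_solve hA hB hP hw, fun c => ⟨2000 * (c + 1), ?_⟩⟩
  intro α n w A B P hA hB hP hw hc
  obtain ⟨m, t, τ, hexec, hans, ht, hm⟩ := StrIcLcs.solvesWithin_solve hA hB hP hw
  refine ⟨m, t, τ, hexec, hans, ht, hm.trans ?_⟩
  rw [Nat.mul_assoc]
  refine Nat.mul_le_mul_left _ ?_
  have hl : StrIcLcs.lcs A B ≤ n := by
    rw [StrIcLcs.lcs_eq_prefixLcs hA hB]
    exact (StrIcLcs.isGrid_prefixLcs A B).le_left n n
  rcases hc with hc | hc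
  · exact Nat.mul_le_mul (by omega) (by omega)
  · rw [Nat.mul_comm]
    exact Nat.mul_le_mul (by omega) (by omega)
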